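/- All digraphs are finite oriented graphs (no loops, at most one arc between two vertices). For a vertex $v$ of $D$, $N^+(v)$ and $N^-(v)$ denote its out- and in-neighbourhoods and $N^{++}(v)$ the set of vertices $u\notin N^+(v)$ with $v\to w\to u$ for some $w$; $v$ has the second neighbourhood property (SNP) in $D$ if $|N^+(v)|\le |N^{++}(v)|$. A missing edge of $D$ is a pair $xy$ of distinct vertices with no arc between them, and a vertex incident to no missing edge is whole. A missing edge $xy$ loses to a missing edge $ab$, written $xy\to ab$, if for some naming of the ends $x\to a$, $b\notin N^+(x)\cup N^{++}(x)$, $y\to b$ and $a\notin N^+(y)\cup N^{++}(y)$. The dependency digraph $\Delta=\Delta(D)$ has the missing edges as its vertices and the pairs $(xy,ab)$ with $xy\to ab$ as its arcs. For a connected component $C$ of (the underlying graph of) $\Delta$ let $K(C)$ be the set of ends of the missing edges in $C$. The interval graph $\mathcal I_D$ has the connected components of $\Delta$ as its vertices, two different ones being adjacent if their sets $K(\cdot)$ meet; for a connected component $\xi$ of $\mathcal I_D$ let $K(\xi)=\bigcup_{C\in\xi}K(C)$. Put $J(x)=J_D(x)=\{x\}$ if $x$ is whole, and otherwise $J(x)=K(\xi)$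 for the unique $\xi$ with $x\in K(\xi)$. A set $S$ of vertices is an interval of $D$ if $N^+(u)\setminus S=N^+(v)\setminus S$ and $N^-(u)\setminus S=N^-(v)\setminus S$ for all $u,v\in S$. $D$ is good if all the sets $K(\xi)$ are intervals of $D$; a good completion of $D$ is a good digraph $D'$ with $V(D')=V(D)$ and $E(D)\subseteq E(D')$. A median order of a digraph is a linear order of its vertices with the largest possible number of arcs directed from left to right, and a feed vertex is the last vertex of a median order. **Theorem.** Let $D$ be a digraph such that every vertex $x$ of $D$ satisfies (i) or (ii): (i) $J(x)=K(P)$ for a directed path $P$ in $\Delta$; that is, $J(x)=K(\xi)$ where $\xi=\{P\}$ consists of a single connected component $P$ of $\Delta$, and $P$ is a directed path (a single missing edge being allowed): its missing edges can be listed as $e_1,\dots,e_k$, $k\ge 1$, without repetition, such that the arcs of $\Delta$ among them are exactly $e_i\to e_{i+1}$, $1\le i<k$; (ii) $J(x)$ is an interval of $D$ and some vertex $p\in J(x)$ has the SNP in the induced digraph $D[J(x)]$. Then $D$ has a good completion $D'$ such that for every feed vertex $f$ of $D'$ there is $p\in J_{D'}(f)$ that has the SNP both in $D'$ and in $D$.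 -/

import Mathlib

/-- An oriented graph on the vertex set `V`: a digraph with at most one arc between any two
vertices and no loops (`asymm` with `u = v` excludes loops). -/
structure OrientedGraph (V : Type*) extends Digraph V where
  asymm : ∀ u v, Adj u v → ¬ Adj v u

namespace OrientedGraph

variable {V : Type*}

/-- The out-neighbourhood `N⁺(v)`. -/
def outN (D : OrientedGraph V) (v : V) : Set V := {u | D.Adj v u}

/-- The in-neighbourhood `N⁻(v)`. -/
def inN (D : OrientedGraph V) (v : V) : Set V := {u | D.Adj u v}

/-- The second out-neighbourhood `N⁺⁺(v)`: the vertices at distance exactly two from `v`.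
(Asymmetry of the arcs already excludes `u = v`.) -/
def secondOutN (D : OrientedGraph V) (v : V) : Set V :=
  {u | ¬ D.Adj v u ∧ ∃ w, D.Adj v w ∧ D.Adj w u}

/-- The second neighbourhood property of a vertex of a (finite) oriented graph. -/
def SNP (D : OrientedGraph V) (v : V) : Prop :=
  (D.outN v).ncard ≤ (D.secondOutN v).ncard

/-- The oriented graph `D[K]` induced by `K`. -/
def induce (D : OrientedGraph V) (K : Set V) : OrientedGraph K where
  Adj u v := D.Adj u v
  asymm u v h := D.asymm u v h

/-- The graph of missing edges: `xy` is a missing edge if `x ≠ y` and there is no arc between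
`x` and `y`. (Whole vertices are kept as isolated vertices.) -/
def missingGraph (D : OrientedGraph V) : SimpleGraph V where
  Adj x y := x ≠ y ∧ ¬ D.Adj x y ∧ ¬ D.Adj y x
  symm := ⟨fun _ _ h => ⟨h.1.symm, h.2.2, h.2.1⟩⟩
  loopless := ⟨fun _ h => h.1 rfl⟩

/-- A whole vertex is a vertex incident to no missing edge. -/
def IsWhole (D : OrientedGraph V) (v : V) : Prop := ∀ x, ¬ D.missingGraph.Adj v x

/-- The type of (unordered) missing edges of `D`. -/
abbrev MissingEdge (D : OrientedGraph V) : Type _ := D.missingGraph.edgeSet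

/-- The losing relation for missing edges with named ends: `x → a`, `b ∉ N⁺(x) ∪ N⁺⁺(x)`,
`y → b` and `a ∉ N⁺(y) ∪ N⁺⁺(y)`. -/
def Loses (D : OrientedGraph V) (x y a b : V) : Prop :=
  D.Adj x a ∧ b ∉ D.outN x ∪ D.secondOutN x ∧ D.Adj y b ∧ a ∉ D.outN y ∪ D.secondOutN y

/-- The dependency digraph `Δ(D)` on the missing edges of `D`: `e → f` if `e` loses to `f` for
some naming of the ends. -/
def dependency (D : OrientedGraph V) : Digraph D.MissingEdge where
  Adj e f := ∃ x y a b, e.1 = s(x, y) ∧ f.1 = s(a, b) ∧ D.Loses x y a b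

/-- The connected components of `Δ(D)` (of its underlying undirected graph). -/
abbrev DepComponent (D : OrientedGraph V) : Type _ :=
  D.dependency.toSimpleGraphInclusive.ConnectedComponent

/-- `K(C)`: the vertices of `D` incident to a missing edge belonging to `C`. -/
def K (D : OrientedGraph V) (C : D.DepComponent) : Set V :=
  {u | ∃ e ∈ C.supp, u ∈ e.1}

/-- The interval graph `I_D`: its vertices are the connected components of `Δ(D)`, and two
different ones are adjacent if `K(C₁)` and `K(C₂)` meet. -/
def intervalGraph (D : OrientedGraph V) : SimpleGraph D.DepComponent where
  Adj C₁ C₂ := C₁ ≠ C₂ ∧ (D.K C₁ ∩ D.K C₂).Nonempty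
  symm := ⟨fun _ _ h => ⟨h.1.symm, Set.inter_comm _ _ ▸ h.2⟩⟩
  loopless := ⟨fun _ h => h.1 rfl⟩

/-- The connected components `ξ` of the interval graph. -/
abbrev IntervalComponent (D : OrientedGraph V) : Type _ := D.intervalGraph.ConnectedComponent

/-- `K(ξ)`: the union of the sets `K(C)` over `C ∈ ξ`. -/
def KK (D : OrientedGraph V) (ξ : D.IntervalComponent) : Set V := ⋃ C ∈ ξ.supp, D.K C

open Classical in
/-- `J(x) = {x}` if `x` is whole, and otherwise `J(x) = K(ξ)` for the component `ξ` with
`x ∈ K(ξ)` (there is exactly one, so that the union has exactly one term). -/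
noncomputable def J (D : OrientedGraph V) (x : V) : Set V :=
  if D.IsWhole x then {x} else ⋃ (ξ : D.IntervalComponent) (_ : x ∈ D.KK ξ), D.KK ξ

/-- `S` is an interval of `D`: all vertices of `S` have the same out-neighbours and the same
in-neighbours outside `S`. -/
def IsInterval (D : OrientedGraph V) (S : Set V) : Prop :=
  ∀ u ∈ S, ∀ v ∈ S, D.outN u \ S = D.outN v \ S ∧ D.inN u \ S = D.inN v \ S

/-- A good digraph: all the sets `K(ξ)` are intervals. -/
def IsGood (D : OrientedGraph V) : Prop := ∀ ξ : D.IntervalComponent, D.IsInterval (D.KK ξ)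

/-- `D'` is a good completion of `D` (on the same vertex set). -/
def IsGoodCompletion (D D' : OrientedGraph V) : Prop :=
  (∀ u v, D.Adj u v → D'.Adj u v) ∧ D'.IsGood

/-- The arcs directed from left to right for the linear order `L` of the vertices, where `L v` is
the position of `v`. -/
def forwardArcs (D : OrientedGraph V) (L : V ≃ Fin (Nat.card V)) : Set (V × V) :=
  {p | D.Adj p.1 p.2 ∧ L p.1 < L p.2}

/-- A median order: a linear order of the vertices with as many forward arcs as possible. -/
def IsMedianOrder (D : OrientedGraph V) (L : V ≃ Fin (Nat.card V)) : Prop :=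
  ∀ L' : V ≃ Fin (Nat.card V), (D.forwardArcs L').ncard ≤ (D.forwardArcs L).ncard

/-- A feed vertex: the last vertex of some median order. -/
def IsFeed (D : OrientedGraph V) (f : V) : Prop :=
  ∃ L : V ≃ Fin (Nat.card V), D.IsMedianOrder L ∧ ∀ v, L v ≤ L f

/-- The connected component `P` of `Δ(D)` is a directed path: its missing edges can be listed
as `e₀, e₁, …, e_{k-1}` (without repetition) so that the arcs of `Δ(D)` among them are exactly
`e₀ → e₁ → ⋯ → e_{k-1}`. A single missing edge (`k = 1`) is a path. -/
def IsDirectedPath (D : OrientedGraph V) (P : D.DepComponent) : Prop :=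
  ∃ (k : ℕ) (e : Fin k ≃ P.supp),
    ∀ i j : Fin k, D.dependency.Adj (e i).1 (e j).1 ↔ (i : ℕ) + 1 = (j : ℕ)

/-- `J(x) = K(P)` for a directed path `P` in `Δ(D)`: the component `ξ` of the interval graph
with `J(x) = K(ξ)` consists of a single component `P` of `Δ(D)`, which is a directed path. -/
def JIsPath (D : OrientedGraph V) (x : V) : Prop :=
  ∃ (P : D.DepComponent) (ξ : D.IntervalComponent),
    D.IsDirectedPath P ∧ ξ.supp = {P} ∧ D.J x = D.K P

/-- `J(x)` is an interval of `D` and contains a vertex with the second neighbourhood property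
in `D[J(x)]`. -/
def JIsSNPInterval (D : OrientedGraph V) (x : V) : Prop :=
  D.IsInterval (D.J x) ∧ ∃ p : D.J x, (D.induce (D.J x)).SNP p

end OrientedGraph

/-! The argument of Havet and Thomassé is run with a skew weight on pairs of vertices in place of
the arcs of a tournament. Arcs weigh one, the first missing edge of every path class weighs one in a
convenient orientation, the other missing edges of the path classes get tiny weights, and those of
interval classes get zero. Let `L` be an order of maximal weight. The completion directs the missing
edges of the path classes from left to right along `L`. It exceeds the weight only on pairs that are
forward in `L`, so every median order of the completion is again of maximal weight
(`IsMaxOrder.of_forward`, `isMaxOrder_of_completion`). Hence its feed vertices are last vertices of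
orders of maximal weight.

Let `f` be such a last vertex. Cutting the order at "bad" vertices, which `f` does not reach in two
steps, and applying the feedback property on each block gives one inequality
(`IsMaxOrder.sum_le_zero`). If the class of `f` is an interval, counting outside it gives the
inequality there, and a vertex `p` with the SNP inside the class has it in `D` (`snp_of_induce`).
The completion changes no arc at `p`, so it has it there too.

If the class of `f` is a path, a missing edge `bz` with `f → z` and `b` unreached either follows a
missing edge at `f` or is the first edge, of weight one from `b` (`loses_or_first`). The vertices
`b` of the first kind cannot be used as bad; they are at most as many as the missing edges at `f`
with a successor, since on a path each edge loses to at most one other. The inequality has integral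
content, so errors of total less than one are harmless. Only boundary effects near the start of the
path are off by a full unit. The three scales of tiny weight, each dominating `|V|` times the sum of
the smaller ones, repair them (`snp_of_no_active_first`, `snp_of_last_of_active_first`). In the
completion `f` is whole and does not distinguish the ends of the remaining missing edges, so it has
the SNP there as well (`snp_of_last_of_isWhole`). -/

section SecondNeighbourhood

open Finset
open scoped Classical

/-! ### Orders of maximal weight and their feedback property. -/

section WeightedOrders

/-- The positions given by an enumeration. -/
noncomputable def positions {V : Type*} (L : V ≃ Fin (Nat.card V)) (v : V) : ℝ := ((L v : ℕ) : ℝ)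

theorem positions_lt {V : Type*} (L : V ≃ Fin (Nat.card V)) (u v : V) :
    positions L u < positions L v ↔ L u < L v :=
  Nat.cast_lt

theorem positions_injective {V : Type*} (L : V ≃ Fin (Nat.card V)) :
    Function.Injective (positions L) := by
  intro u v h
  exact L.injective (Fin.ext (Nat.cast_injective h))

variable {V : Type*} [Fintype V]

/-- The total weight of the pairs directed from left to right, for the positions `q`. -/
noncomputable def orderWeight (ω : V → V → ℝ) (q : V → ℝ) : ℝ :=
  ∑ u, ∑ v, if q u < q v then ω u v else 0

/-- Positions of maximal weight. -/
def IsMaxOrder (ω : V → V → ℝ) (q : V → ℝ) : Prop :=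
  Function.Injective q ∧ ∀ q' : V → ℝ, Function.Injective q' → orderWeight ω q' ≤ orderWeight ω q

/-- In an order of maximal weight, a vertex is not heavier than any interval preceding it. -/
theorem IsMaxOrder.feedback {ω : V → V → ℝ} (hω : ∀ u v, ω u v = -ω v u) {q : V → ℝ}
    (hq : IsMaxOrder ω q) (v : V) (t : ℝ) :
    ∑ u with t < q u ∧ q u < q v, ω v u ≤ 0 := by
  set S : Finset V := univ.filter fun u => t < q u ∧ q u < q v with hS
  rcases S.eq_empty_or_nonempty with h | h
  · simp [h]
  obtain ⟨m, hm, hmin⟩ := S.exists_min_image q h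
  have hm' : t < q m ∧ q m < q v := by simpa [hS] using hm
  -- Moving `v` into the gap just before the block `S` reverses exactly the pairs of `v` with `S`.
  -- By skewness the total weight changes by twice the weight from `v` to `S`, and maximality makes
  -- this nonpositive.
  set c : ℝ := (t + q m) / 2 with hc
  have htc : t < c := by rw [hc]; linarith
  have hcm : c < q m := by rw [hc]; linarith
  have hvS : v ∉ S := by simp [hS]
  have hSc : ∀ u ∈ S, c < q u := fun u hu => lt_of_lt_of_le hcm (hmin u hu)
  have hno : ∀ u, u ∉ S → u ≠ v → (q u < c ∧ q u < q v) ∨ (c < q u ∧ q v < q u) := by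
    intro u hu huv
    have hne : q u ≠ q v := fun h => huv (hq.1 h)
    by_cases h1 : q u < q v
    · left
      refine ⟨?_, h1⟩
      have : ¬ t < q u := fun h2 => hu (by simp [hS, h1, h2])
      linarith
    · right
      have h2 : q v < q u := lt_of_le_of_ne (not_lt.1 h1) hne.symm
      exact ⟨by linarith [hm'.2], h2⟩
  have hcne : ∀ u, u ≠ v → q u ≠ c := by
    intro u huv h
    by_cases hu : u ∈ S
    · have := hSc u hu; linarith
    · rcases hno u hu huv with h1 | h1 <;> linarith [h1.1]
  set q' : V → ℝ := Function.update q v c with hq'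
  have hv' : q' v = c := by simp [hq']
  have hu' : ∀ u, u ≠ v → q' u = q u := fun u hu => by simp [hq', hu]
  have hinj : Function.Injective q' := by
    intro x y hxy
    by_cases hx : x = v <;> by_cases hy : y = v
    · rw [hx, hy]
    · subst hx; rw [hv', hu' y hy] at hxy; exact absurd hxy.symm (hcne y hy)
    · subst hy; rw [hv', hu' x hx] at hxy; exact absurd hxy (hcne x hx)
    · rw [hu' x hx, hu' y hy] at hxy; exact hq.1 hxy
  have hmax := hq.2 q' hinj
  have key : orderWeight ω q' - orderWeight ω q = 2 * ∑ u ∈ S, ω v u := by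
    unfold orderWeight
    rw [← Finset.sum_sub_distrib]
    have : ∀ u, (∑ w, (if q' u < q' w then ω u w else 0)) - (∑ w, if q u < q w then ω u w else 0)
        = ∑ w, ((if u = v then (if w ∈ S then ω v w else 0) else 0)
          - (if w = v then (if u ∈ S then ω u v else 0) else 0)) := by
      intro u
      rw [← Finset.sum_sub_distrib]
      refine Finset.sum_congr rfl fun w _ => ?_
      by_cases hu : u = v <;> by_cases hw : w = v
      · subst hu; subst hw; simp [hvS]
      · subst hu
        rw [hv', hu' w hw]
        by_cases hwS : w ∈ S
        · have h1 := hSc w hwS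
          have h2 : ¬ q u < q w := by
            have : t < q w ∧ q w < q u := by simpa [hS] using hwS
            linarith [this.2]
          simp [h1, h2, hwS, hw]
        · rcases hno w hwS hw with h1 | h1
          · simp [hwS, hw, not_lt.2 h1.1.le, not_lt.2 h1.2.le]
          · simp [hwS, hw, h1.1, h1.2]
      · subst hw
        rw [hv', hu' u hu]
        by_cases huS : u ∈ S
        · have h1 := hSc u huS
          have h2 : q u < q w := by
            have : t < q u ∧ q u < q w := by simpa [hS] using huS
            exact this.2
          simp [not_lt.2 h1.le, h2, huS, hu]
        · rcases hno u huS hu with h1 | h1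
          · simp [huS, hu, h1.1, h1.2]
          · simp [huS, hu, not_lt.2 h1.1.le, not_lt.2 h1.2.le]
      · rw [hu' u hu, hu' w hw]; simp [hu, hw]
    rw [Finset.sum_congr rfl fun u _ => this u]
    simp only [Finset.sum_sub_distrib, Finset.sum_ite_eq', Finset.mem_univ, if_true]
    have h1 : (∑ u : V, ∑ w : V, if u = v then (if w ∈ S then ω v w else 0) else 0)
        = ∑ w ∈ S, ω v w := by
      rw [Finset.sum_comm]
      simp
    have h2 : (∑ u : V, if u ∈ S then ω u v else 0) = - ∑ w ∈ S, ω v w := by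
      rw [← Finset.sum_neg_distrib]
      simp only [Finset.sum_ite_mem, Finset.univ_inter]
      exact Finset.sum_congr rfl fun u _ => hω u v
    rw [h1, h2]; ring
  linarith

/-- The feedback property for the vertices outside a set on which the weight is uniform. -/
theorem IsMaxOrder.feedback_uniform {ω : V → V → ℝ} (hω : ∀ u v, ω u v = -ω v u) {q : V → ℝ}
    (hq : IsMaxOrder ω q) {F : Set V} {f : V} (hF : ∀ x ∈ F, ∀ u ∉ F, ω x u = ω f u) (t : ℝ)
    (x : V) (hx : x ∈ F) :
    ∑ u with u ∉ F ∧ t < q u ∧ q u < q x, ω f u ≤ 0 := by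
  induction hn : (univ.filter fun u => q u < q x).card using Nat.strong_induction_on
    generalizing x with
  | _ n ih =>
    set S : Finset V := univ.filter fun u => u ∈ F ∧ t < q u ∧ q u < q x with hS
    rcases S.eq_empty_or_nonempty with h | h
    · have h1 : (univ.filter fun u => u ∉ F ∧ t < q u ∧ q u < q x)
          = univ.filter fun u => t < q u ∧ q u < q x := by
        ext u
        simp only [mem_filter, mem_univ, true_and]
        refine ⟨fun h => h.2, fun h2 => ⟨fun h3 => ?_, h2⟩⟩
        have : u ∈ S := by simp [hS, h3, h2]
        simp [h] at this
      have h2 := hq.feedback hω x t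
      rw [← h1] at h2
      refine le_of_eq_of_le (Finset.sum_congr rfl fun u hu => ?_) h2
      simp only [mem_filter, mem_univ, true_and] at hu
      exact (hF x hx u hu.1).symm
    -- Behind the last member `y` of `F` in the block there is only the outside, so ordinary
    -- feedback at `x` applies there; the part before `y` is handled by induction.
    · obtain ⟨y, hy, hmax⟩ := S.exists_max_image q h
      have hy' : y ∈ F ∧ t < q y ∧ q y < q x := by simpa [hS] using hy
      have hcard : (univ.filter fun u => q u < q y).card < n := by
        rw [← hn]
        apply Finset.card_lt_card
        refine ⟨fun u hu => ?_, fun hsub => ?_⟩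
        · simp only [mem_filter, mem_univ, true_and] at hu ⊢
          exact hu.trans hy'.2.2
        · have : y ∈ univ.filter fun u => q u < q x := by simp [hy'.2.2]
          have := hsub this
          simp at this
      have h1 := ih _ hcard y hy'.1 rfl
      have h2 := hq.feedback hω x (q y)
      have hsplit : (univ.filter fun u => u ∉ F ∧ t < q u ∧ q u < q x)
          = (univ.filter fun u => u ∉ F ∧ t < q u ∧ q u < q y) ∪
            (univ.filter fun u => q y < q u ∧ q u < q x) := by
        ext u
        simp only [mem_filter, mem_univ, true_and, mem_union]
        constructor
        · rintro ⟨hu, hu1, hu2⟩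
          rcases lt_trichotomy (q u) (q y) with h3 | h3 | h3
          · exact Or.inl ⟨hu, hu1, h3⟩
          · exact absurd (hq.1 h3 ▸ hy'.1) hu
          · exact Or.inr ⟨h3, hu2⟩
        · rintro (⟨hu, hu1, hu2⟩ | ⟨hu1, hu2⟩)
          · exact ⟨hu, hu1, hu2.trans hy'.2.2⟩
          · refine ⟨fun hu => ?_, hy'.2.1.trans hu1, hu2⟩
            have : u ∈ S := by simp [hS, hu, hy'.2.1.trans hu1, hu2]
            exact absurd (hmax u this) (not_le.2 hu1)
      rw [hsplit, Finset.sum_union]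
      · have h3 : ∑ u with q y < q u ∧ q u < q x, ω f u = ∑ u with q y < q u ∧ q u < q x, ω x u := by
          refine Finset.sum_congr rfl fun u hu => ?_
          have : u ∈ univ.filter fun u => u ∉ F ∧ t < q u ∧ q u < q x := by
            rw [hsplit]; exact Finset.mem_union_right _ hu
          simp only [mem_filter, mem_univ, true_and] at this
          exact (hF x hx u this.1).symm
        linarith
      · rw [Finset.disjoint_left]
        intro u hu hu2
        simp only [mem_filter, mem_univ, true_and] at hu hu2
        linarith [hu.2.2, hu2.1]

/-- A weighted form of the argument of Havet and Thomassé: `f` is the last vertex of an order of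
maximal weight, `F` is a uniform set containing `f`, and `g` is dominated by the weight of `f` and,
to the left of each `b ∈ B`, by that of `b`. -/
theorem IsMaxOrder.sum_le_zero {ω : V → V → ℝ} (hω : ∀ u v, ω u v = -ω v u) {q : V → ℝ}
    (hq : IsMaxOrder ω q) {F B : Set V} {f : V} (hfF : f ∈ F)
    (hF : ∀ x ∈ F, ∀ u ∉ F, ω x u = ω f u) (hf : ∀ v, q v ≤ q f)
    (hB : ∀ b ∈ B, ∀ u ∈ F, q u < q b → 0 ≤ ω b u) {g : V → ℝ}
    (hg : ∀ u, u ∉ F → u ∉ B → g u ≤ ω f u)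
    (hgB : ∀ b ∈ B, ∀ u, u ∉ F → u ∉ B → g u ≤ ω b u) :
    ∑ u with u ∉ F ∧ u ∉ B, g u ≤ 0 := by
  have main : ∀ n : ℕ, ∀ t : ℝ, (univ.filter fun u => t < q u).card = n →
      ∑ u with (u ∉ F ∧ u ∉ B) ∧ t < q u, g u ≤ 0 := by
    intro n
    induction n using Nat.strong_induction_on with
    | _ n ih =>
      intro t hn
      set S : Finset V := univ.filter fun b => b ∈ B ∧ t < q b with hS
      rcases S.eq_empty_or_nonempty with h | h
      · have h1 := hq.feedback_uniform hω hF t f hfF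
        refine le_trans ?_ h1
        have h2 : (univ.filter fun u => (u ∉ F ∧ u ∉ B) ∧ t < q u)
            = univ.filter fun u => u ∉ F ∧ t < q u ∧ q u < q f := by
          ext u
          simp only [mem_filter, mem_univ, true_and]
          constructor
          · rintro ⟨⟨h3, h4⟩, h5⟩
            refine ⟨h3, h5, lt_of_le_of_ne (hf u) fun h6 => h3 (hq.1 h6 ▸ hfF)⟩
          · rintro ⟨h3, h4, h5⟩
            refine ⟨⟨h3, fun h6 => ?_⟩, h4⟩
            have : u ∈ S := by simp [hS, h6, h4]
            simp [h] at this
        have h3 : ∀ u ∈ univ.filter (fun u => (u ∉ F ∧ u ∉ B) ∧ t < q u), g u ≤ ω f u := by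
          intro u hu
          simp only [mem_filter, mem_univ, true_and] at hu
          exact hg u hu.1.1 hu.1.2
        exact le_of_le_of_eq (Finset.sum_le_sum h3) (by rw [h2])
      -- The block before the first bad vertex `b` is charged to the feedback at `b`. Members of `F`
      -- in it have nonnegative weight from `b` and may be dropped; the rest is the induction
      -- hypothesis at threshold `q b`.
      · obtain ⟨b, hb, hmin⟩ := S.exists_min_image q h
        have hb' : b ∈ B ∧ t < q b := by simpa [hS] using hb
        have hcard : (univ.filter fun u => q b < q u).card < n := by
          rw [← hn]
          apply Finset.card_lt_card
          refine ⟨fun u hu => ?_, fun hsub => ?_⟩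
          · simp only [mem_filter, mem_univ, true_and] at hu ⊢
            exact hb'.2.trans hu
          · have : b ∈ univ.filter fun u => t < q u := by simp [hb'.2]
            have := hsub this
            simp at this
        have h1 := ih _ hcard (q b) rfl
        have h2 := hq.feedback hω b t
        have hsplit : (univ.filter fun u => (u ∉ F ∧ u ∉ B) ∧ t < q u)
            = (univ.filter fun u => u ∉ F ∧ t < q u ∧ q u < q b) ∪
              (univ.filter fun u => (u ∉ F ∧ u ∉ B) ∧ q b < q u) := by
          ext u
          simp only [mem_filter, mem_univ, true_and, mem_union]
          constructor
          · rintro ⟨⟨hu, hu1⟩, hu2⟩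
            rcases lt_trichotomy (q u) (q b) with h3 | h3 | h3
            · exact Or.inl ⟨hu, hu2, h3⟩
            · exact absurd (hq.1 h3 ▸ hb'.1) hu1
            · exact Or.inr ⟨⟨hu, hu1⟩, h3⟩
          · rintro (⟨hu, hu1, hu2⟩ | ⟨hu1, hu2⟩)
            · refine ⟨⟨hu, fun hu3 => ?_⟩, hu1⟩
              have : u ∈ S := by simp [hS, hu3, hu1]
              exact absurd (hmin u this) (not_le.2 hu2)
            · exact ⟨hu1, hb'.2.trans hu2⟩
        rw [hsplit, Finset.sum_union]
        · have h3 : ∑ u with u ∉ F ∧ t < q u ∧ q u < q b, g u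
              ≤ ∑ u with t < q u ∧ q u < q b, ω b u := by
            calc ∑ u with u ∉ F ∧ t < q u ∧ q u < q b, g u
                ≤ ∑ u with u ∉ F ∧ t < q u ∧ q u < q b, ω b u := by
                  refine Finset.sum_le_sum fun u hu => ?_
                  have : u ∈ univ.filter fun u => (u ∉ F ∧ u ∉ B) ∧ t < q u := by
                    rw [hsplit]; exact Finset.mem_union_left _ hu
                  simp only [mem_filter, mem_univ, true_and] at this
                  exact hgB b hb'.1 u this.1.1 this.1.2
              _ ≤ _ := by
                  refine Finset.sum_le_sum_of_subset_of_nonneg ?_ ?_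
                  · intro u hu
                    simp only [mem_filter, mem_univ, true_and] at hu ⊢
                    exact hu.2
                  · intro u hu hu2
                    simp only [mem_filter, mem_univ, true_and] at hu hu2
                    refine hB b hb'.1 u ?_ hu.2
                    by_contra hc
                    exact hu2 ⟨hc, hu⟩
          linarith
        · rw [Finset.disjoint_left]
          intro u hu hu2
          simp only [mem_filter, mem_univ, true_and] at hu hu2
          linarith [hu.2.2, hu2.2]
  obtain ⟨m, hm⟩ : ∃ m : ℝ, ∀ u, m < q u := by
    obtain ⟨y, -, hy⟩ := (univ : Finset V).exists_min_image q ⟨f, mem_univ f⟩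
    exact ⟨q y - 1, fun u => by linarith [hy u (mem_univ u)]⟩
  have := main _ m rfl
  simpa [hm] using this

/-- Every injective choice of positions is realized by an enumeration. -/
theorem exists_enumeration {q : V → ℝ} (hq : Function.Injective q) :
    ∃ L : V ≃ Fin (Nat.card V), ∀ u v, L u < L v ↔ q u < q v := by
  let _ : LinearOrder V := LinearOrder.lift' q hq
  have hc : Fintype.card V = Nat.card V := Nat.card_eq_fintype_card.symm
  let e := Fintype.orderIsoFinOfCardEq V hc
  refine ⟨e.symm.toEquiv, fun u v => ?_⟩
  exact e.symm.lt_iff_lt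

theorem orderWeight_congr {ω : V → V → ℝ} {q q' : V → ℝ} (h : ∀ u v, q u < q v ↔ q' u < q' v) :
    orderWeight ω q = orderWeight ω q' := by
  unfold orderWeight
  simp only [h]

theorem isMaxOrder_of_enumerations {ω : V → V → ℝ} {L : V ≃ Fin (Nat.card V)}
    (h : ∀ L' : V ≃ Fin (Nat.card V),
      orderWeight ω (positions L') ≤ orderWeight ω (positions L)) :
    IsMaxOrder ω (positions L) := by
  refine ⟨positions_injective L, fun q' hq' => ?_⟩
  obtain ⟨L', hL'⟩ := exists_enumeration hq'
  rw [orderWeight_congr (q' := positions L') fun u v => by rw [positions_lt, hL']]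
  exact h L'

theorem exists_isMaxOrder (ω : V → V → ℝ) :
    ∃ L : V ≃ Fin (Nat.card V), IsMaxOrder ω (positions L) := by
  have : Nonempty (V ≃ Fin (Nat.card V)) := ⟨Finite.equivFin V⟩
  obtain ⟨L, hL⟩ := Finite.exists_max fun L : V ≃ Fin (Nat.card V) => orderWeight ω (positions L)
  exact ⟨L, isMaxOrder_of_enumerations hL⟩

/-- If `ω'` exceeds the skew weight `ω` only on pairs that are forward in an order of maximal
`ω`-weight, and only there, then orders of maximal `ω'`-weight have maximal `ω`-weight. -/
theorem IsMaxOrder.of_forward {ω ω' : V → V → ℝ} {q₀ q : V → ℝ} (h₀ : IsMaxOrder ω q₀)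
    (h1 : ∀ u v, q₀ u < q₀ v → ω u v ≤ ω' u v) (h2 : ∀ u v, ¬ q₀ u < q₀ v → ω' u v ≤ ω u v)
    (hq : IsMaxOrder ω' q) : IsMaxOrder ω q := by
  refine ⟨hq.1, fun q' hq' => (h₀.2 q' hq').trans ?_⟩
  have h3 := hq.2 q₀ h₀.1
  -- The order `q₀` collects the difference `ω' - ω` wherever it may be positive and avoids it
  -- elsewhere, so no order collects more.
  have h4 : orderWeight ω' q - orderWeight ω q ≤ orderWeight ω' q₀ - orderWeight ω q₀ := by
    unfold orderWeight
    rw [← Finset.sum_sub_distrib, ← Finset.sum_sub_distrib]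
    refine Finset.sum_le_sum fun u _ => ?_
    rw [← Finset.sum_sub_distrib, ← Finset.sum_sub_distrib]
    refine Finset.sum_le_sum fun v _ => ?_
    by_cases h5 : q₀ u < q₀ v
    · have := h1 u v h5
      by_cases h6 : q u < q v <;> simp [h5, h6]; linarith
    · have := h2 u v h5
      by_cases h6 : q u < q v <;> simp [h5, h6]; linarith
  linarith

end WeightedOrders

/-! ### Median orders as orders of maximal weight. -/

namespace OrientedGraph

variable {V : Type*}

/-- The skew weight of the arcs of an oriented graph. -/
noncomputable def arcWeight (D : OrientedGraph V) (u v : V) : ℝ :=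
  (if D.Adj u v then 1 else 0) - (if D.Adj v u then 1 else 0)

theorem arcWeight_skew (D : OrientedGraph V) (u v : V) : D.arcWeight u v = -D.arcWeight v u := by
  unfold arcWeight; ring

theorem arcWeight_of_adj {D : OrientedGraph V} {u v : V} (h : D.Adj u v) : D.arcWeight u v = 1 := by
  simp [arcWeight, h, D.asymm u v h]

variable [Fintype V]

theorem orderWeight_arcWeight (D : OrientedGraph V) (L : V ≃ Fin (Nat.card V)) :
    orderWeight D.arcWeight (positions L) =
      2 * ((D.forwardArcs L).ncard : ℝ) - ∑ u, ∑ v, if D.Adj u v then (1 : ℝ) else 0 := by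
  have h1 : ((D.forwardArcs L).ncard : ℝ)
      = ∑ u, ∑ v, if positions L u < positions L v ∧ D.Adj u v then (1 : ℝ) else 0 := by
    rw [← Finset.sum_product', Set.ncard_eq_toFinset_card', Finset.sum_boole]
    congr 2
    ext ⟨u, v⟩
    rw [Set.mem_toFinset, mem_filter, positions_lt, and_comm (a := L u < L v)]
    simp [forwardArcs]
  have h2 : ∑ u, ∑ v, (if positions L u < positions L v ∧ D.Adj v u then (1 : ℝ) else 0)
      = (∑ u, ∑ v, if D.Adj u v then (1 : ℝ) else 0)
        - ∑ u, ∑ v, if positions L u < positions L v ∧ D.Adj u v then (1 : ℝ) else 0 := by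
    rw [Finset.sum_comm, ← Finset.sum_sub_distrib]
    refine Finset.sum_congr rfl fun u _ => ?_
    rw [← Finset.sum_sub_distrib]
    refine Finset.sum_congr rfl fun v _ => ?_
    by_cases h : D.Adj u v
    · have hne : u ≠ v := by rintro rfl; exact D.asymm u u h h
      rcases lt_or_gt_of_ne ((positions_injective L).ne hne) with h3 | h3
      · simp [h, h3, not_lt.2 h3.le]
      · simp [h, h3, not_lt.2 h3.le]
    · simp [h]
  rw [h1, orderWeight]
  have h3 : ∑ u, ∑ v, (if positions L u < positions L v then D.arcWeight u v else 0)
      = (∑ u, ∑ v, if positions L u < positions L v ∧ D.Adj u v then (1 : ℝ) else 0)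
        - ∑ u, ∑ v, (if positions L u < positions L v ∧ D.Adj v u then (1 : ℝ) else 0) := by
    rw [← Finset.sum_sub_distrib]
    refine Finset.sum_congr rfl fun u _ => ?_
    rw [← Finset.sum_sub_distrib]
    refine Finset.sum_congr rfl fun v _ => ?_
    by_cases h : positions L u < positions L v <;> simp [h, arcWeight]
  rw [h3, h2]; ring

theorem IsMedianOrder.isMaxOrder {D : OrientedGraph V} {L : V ≃ Fin (Nat.card V)}
    (h : D.IsMedianOrder L) : IsMaxOrder D.arcWeight (positions L) := by
  refine isMaxOrder_of_enumerations fun L' => ?_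
  rw [orderWeight_arcWeight, orderWeight_arcWeight]
  have : ((D.forwardArcs L').ncard : ℝ) ≤ (D.forwardArcs L).ncard := by exact_mod_cast h L'
  linarith

end OrientedGraph

/-! ### The losing relation and an abstract form of the path classes. -/

namespace OrientedGraph

variable {V : Type*}

/-- `b` is reached from `f` by no directed path of length one or two. -/
def Unreached (D : OrientedGraph V) (f b : V) : Prop := b ∉ D.outN f ∪ D.secondOutN f

theorem unreached_iff {D : OrientedGraph V} {f b : V} :
    D.Unreached f b ↔ ¬ D.Adj f b ∧ ∀ w, D.Adj f w → ¬ D.Adj w b := by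
  simp only [Unreached, outN, secondOutN, Set.mem_union, Set.mem_ofPred_eq, not_or, not_and,
    not_exists]
  exact ⟨fun h => ⟨h.1, fun w => h.2 h.1 w⟩, fun h => ⟨h.1, fun _ => h.2⟩⟩

theorem loses_iff {D : OrientedGraph V} {x y a b : V} :
    D.Loses x y a b ↔ D.Adj x a ∧ D.Unreached x b ∧ D.Adj y b ∧ D.Unreached y a :=
  Iff.rfl

theorem Loses.symm {D : OrientedGraph V} {x y a b : V} (h : D.Loses x y a b) : D.Loses y x b a :=
  ⟨h.2.2.1, h.2.2.2, h.1, h.2.1⟩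

/-- Some missing edge loses to `uv`. -/
def HasPred (D : OrientedGraph V) (u v : V) : Prop :=
  ∃ p q, D.missingGraph.Adj p q ∧ D.Loses p q u v

/-- The pair `uv` loses to some missing edge. -/
def HasSucc (D : OrientedGraph V) (u v : V) : Prop :=
  ∃ x y, D.missingGraph.Adj x y ∧ D.Loses u v x y

theorem missing_or_adj (D : OrientedGraph V) {u v : V} (h : u ≠ v) :
    D.Adj u v ∨ D.Adj v u ∨ D.missingGraph.Adj u v := by
  by_cases h1 : D.Adj u v
  · exact Or.inl h1
  by_cases h2 : D.Adj v u
  · exact Or.inr (Or.inl h2)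
  exact Or.inr (Or.inr ⟨h, h1, h2⟩)

/-- A missing edge `zb` with a predecessor, where `f → z` but `b` is unreached from `f`, has a
predecessor at `f`. -/
theorem HasPred.exists_loses {D : OrientedGraph V} {f z b : V} (hfz : D.Adj f z)
    (hfb : D.Unreached f b) (h : D.HasPred z b) :
    ∃ q, D.missingGraph.Adj f q ∧ D.Loses f q z b := by
  obtain ⟨p, q, -, hl⟩ := h
  obtain ⟨-, -, hqb, hqz⟩ := loses_iff.1 hl
  have h1 := unreached_iff.1 hfb
  refine ⟨q, ⟨?_, fun h => h1.2 q h hqb, fun h => (unreached_iff.1 hqz).2 f h hfz⟩,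
    loses_iff.2 ⟨hfz, hfb, hqb, hqz⟩⟩
  rintro rfl
  exact h1.1 hqb

/-- The mirror image of `HasPred.exists_loses`: an arc `x → b` would reach `b` from `f`, and `b → x`
would reach `x` from `w`. -/
theorem HasSucc.exists_loses {D : OrientedGraph V} {f w b : V} (h : D.HasSucc f w)
    (hwb : D.Adj w b) (hfb : D.Unreached f b) :
    ∃ x, D.missingGraph.Adj x b ∧ D.Loses f w x b := by
  obtain ⟨x, y, -, hl⟩ := h
  obtain ⟨hfx, -, -, hwx⟩ := loses_iff.1 hl
  have h1 := unreached_iff.1 hfb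
  refine ⟨x, ⟨?_, h1.2 x hfx, (unreached_iff.1 hwx).2 b hwb⟩, loses_iff.2 ⟨hfx, hfb, hwb, hwx⟩⟩
  rintro rfl
  exact h1.1 hfx

/-- What is used of the components of the dependency digraph: `R` relates the vertices of the same
component, `T` holds for the components that are directed paths, and `A` orients the first missing
edge of each of these paths. -/
structure PathStructure (D : OrientedGraph V) where
  T : V → Prop
  R : V → V → Prop
  A : V → V → Prop
  equiv : Equivalence R
  rel_of_missing : ∀ {u v}, D.missingGraph.Adj u v → R u v
  path_congr : ∀ {u v}, R u v → T u → T v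
  first_missing : ∀ {u v}, A u v → D.missingGraph.Adj u v
  first_path : ∀ {u v}, A u v → T u
  first_reached : ∀ {u v}, A u v → ∀ p, D.Adj p u → ¬ D.Unreached p v
  first_of_source : ∀ {u v}, D.missingGraph.Adj u v → T u → ¬ D.HasPred u v → A u v ∨ A v u
  first_unique : ∀ {u v u' v'}, A u v → A u' v' → R u u' → u = u' ∧ v = v'
  loses_unique : ∀ {f w x y x' y'}, T f → D.missingGraph.Adj f w → D.missingGraph.Adj x y →
    D.missingGraph.Adj x' y' → D.Loses f w x y → D.Loses f w x' y' → s(x, y) = s(x', y')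
  rel_of_loses : ∀ {f w x y}, D.missingGraph.Adj f w → D.missingGraph.Adj x y →
    D.Loses f w x y → R f y
  out_congr : ∀ {u v x}, ¬ T u → R u v → ¬ R u x → D.Adj u x → D.Adj v x
  in_congr : ∀ {u v x}, ¬ T u → R u v → ¬ R u x → D.Adj x u → D.Adj x v

namespace PathStructure

variable {D : OrientedGraph V} (S : D.PathStructure)

theorem path_iff {u v : V} (h : S.R u v) : S.T u ↔ S.T v :=
  ⟨S.path_congr h, S.path_congr (S.equiv.symm h)⟩

theorem first_asymm {u v : V} (h : S.A u v) : ¬ S.A v u := fun h' =>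
  (S.first_missing h).ne (S.first_unique h h' (S.rel_of_missing (S.first_missing h))).1

/-- `uv` is a missing edge to which a first missing edge loses. -/
def IsSecond (u v : V) : Prop := ∃ a b, S.A a b ∧ D.missingGraph.Adj u v ∧ D.Loses a b u v

/-- If `f → z` and `b` is unreached from `f`, then a missing edge `bz` is preceded by a missing
edge at `f`, or it is the first edge of its path. -/
theorem loses_or_first {f z b : V} (hf : S.T f ∨ ¬ S.R f b) (hfz : D.Adj f z)
    (hfb : D.Unreached f b) (hbz : D.missingGraph.Adj b z) :
    (∃ q, D.missingGraph.Adj f q ∧ D.Loses f q z b) ∨ S.A b z := by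
  by_cases hp : D.HasPred z b
  · exact Or.inl (hp.exists_loses hfz hfb)
  right
  -- In an interval class the arc `f → z` would extend to `f → b`.
  have hT : S.T z := by
    by_contra hz
    have hzb := S.rel_of_missing hbz.symm
    refine (unreached_iff.1 hfb).1 (S.in_congr hz hzb (fun h => ?_) hfz)
    rcases hf with hf | hf
    · exact hz (S.path_congr (S.equiv.symm h) hf)
    · exact hf (S.equiv.trans (S.equiv.symm h) hzb)
  rcases S.first_of_source hbz.symm hT hp with h | h
  · exact absurd hfb (S.first_reached h f hfz)
  · exact h

/-- The unreached ends of missing edges that follow a missing edge `fw` with `w ∈ W`. -/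
def succs (f : V) (W : Set V) : Set V :=
  {b | ∃ w ∈ W, ∃ x, D.missingGraph.Adj f w ∧ D.missingGraph.Adj x b ∧ D.Loses f w x b}

theorem loses_unique_right {f w x y x' y' : V} (hf : S.T f) (hw : D.missingGraph.Adj f w)
    (h : D.missingGraph.Adj x y) (h' : D.missingGraph.Adj x' y') (hl : D.Loses f w x y)
    (hl' : D.Loses f w x' y') : x = x' ∧ y = y' := by
  rcases Sym2.eq_iff.1 (S.loses_unique hf hw h h' hl hl') with h1 | ⟨h1, h2⟩
  · exact h1
  · subst h1
    exact absurd hl.1 (unreached_iff.1 (loses_iff.1 hl').2.1).1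

/-- The vertices that have to be excused from being bad are paid for by missing edges at `f`: an
edge `fw` loses to at most one edge, whose unreached end is determined. -/
theorem ncard_succs_le [Finite V] {f : V} (hf : S.T f) (W : Set V) :
    (succs (D := D) f W).ncard ≤ {w | w ∈ W ∧ D.missingGraph.Adj f w ∧ D.HasSucc f w}.ncard := by
  have h : ∀ b ∈ succs (D := D) f W, ∃ w, (w ∈ W ∧ D.missingGraph.Adj f w ∧ D.HasSucc f w) ∧
      ∃ x, D.missingGraph.Adj x b ∧ D.Loses f w x b := by
    rintro b ⟨w, hw, x, h1, h2, h3⟩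
    exact ⟨w, ⟨hw, h1, x, b, h2, h3⟩, x, h2, h3⟩
  choose! σ hσ hσ' using h
  refine Set.ncard_le_ncard_of_injOn σ hσ ?_ (Set.toFinite _)
  intro b hb b' hb' heq
  obtain ⟨x, h1, h2⟩ := hσ' b hb
  obtain ⟨x', h1', h2'⟩ := hσ' b' hb'
  rw [← heq] at h2'
  exact (S.loses_unique_right hf (hσ b hb).2.1 h1 h1' h2 h2').2

/-- An unreached vertex `w` for which `fw` has a successor. -/
theorem mem_succs_or_first {f w : V} (hf : S.T f) (hw : D.missingGraph.Adj f w)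
    (hs : D.HasSucc f w) (hfw : D.Unreached f w) :
    w ∈ succs (D := D) f Set.univ ∨ ∃ x, S.A w x ∧ D.Adj f x := by
  obtain ⟨x, y, -, hl⟩ := hs
  obtain ⟨hfx, -, -, hwx⟩ := loses_iff.1 hl
  have hx : D.missingGraph.Adj w x := by
    refine ⟨?_, (unreached_iff.1 hwx).1, (unreached_iff.1 hfw).2 x hfx⟩
    rintro rfl
    exact hw.2.1 hfx
  rcases S.loses_or_first (Or.inl hf) hfx hfw hx with ⟨q, h1, h2⟩ | h
  · exact Or.inl ⟨q, trivial, x, h1, hx.symm, h2⟩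
  · exact Or.inr ⟨x, h, hfx⟩

/-! ### The perturbed weight and its three scales. -/

section Weight

variable (N : ℝ)

/-- The small preferences among the missing edges of the paths. -/
noncomputable def preference (u v : V) : ℝ :=
  (if ∃ b, S.A v b then 1 / (4 * N) else 0) + (if S.IsSecond u v then 1 / (4 * N) ^ 2 else 0) +
    (if ∃ b, S.IsSecond v b then 1 / (4 * N) ^ 3 else 0)

/-- The skew weight on the pairs of vertices: the arcs and the first missing edges have weight
one, and the other missing edges of the paths have small weights. -/
noncomputable def weight (u v : V) : ℝ :=
  if D.Adj u v then 1 else if D.Adj v u then -1 else if S.A u v then 1 else if S.A v u then -1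
  else if D.missingGraph.Adj u v ∧ S.T u then S.preference N u v - S.preference N v u else 0

theorem weight_of_adj {u v : V} (h : D.Adj u v) : S.weight N u v = 1 := by
  simp [weight, h]

theorem weight_of_first {u v : V} (h : S.A u v) : S.weight N u v = 1 := by
  have := S.first_missing h
  simp [weight, h, this.2.1, this.2.2]

theorem weight_skew (u v : V) : S.weight N u v = -S.weight N v u := by
  by_cases h1 : D.Adj u v
  · simp [weight, h1, D.asymm u v h1]
  by_cases h2 : D.Adj v u
  · simp [weight, h1, h2]
  by_cases h3 : S.A u v
  · simp [weight, h1, h2, h3, S.first_asymm h3]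
  by_cases h4 : S.A v u
  · simp [weight, h1, h2, h3, h4]
  by_cases h5 : D.missingGraph.Adj u v
  · have h6 := S.path_iff (S.rel_of_missing h5)
    by_cases h7 : S.T v
    · simp [weight, h1, h2, h3, h4, h5, h5.symm, h6, h7]
    · simp [weight, h1, h2, h3, h4, h5, h5.symm, h6, h7]
  · have h6 : ¬ D.missingGraph.Adj v u := fun h => h5 h.symm
    simp [weight, h1, h2, h3, h4, h5, h6]

theorem le_weight {u v : V} {c : ℝ} (hc : c ≤ 1) (h : D.missingGraph.Adj u v) (hT : S.T u)
    (hA : ¬ S.A v u) (hp : c ≤ S.preference N u v - S.preference N v u) : c ≤ S.weight N u v := by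
  unfold weight
  rw [if_neg h.2.1, if_neg h.2.2, if_neg hA, if_pos (And.intro h hT)]
  split_ifs <;> assumption

theorem preference_nonneg (hN : 1 ≤ N) (u v : V) : 0 ≤ S.preference N u v := by
  unfold preference
  have : 0 < 4 * N := by linarith
  positivity

theorem preference_le (hN : 1 ≤ N) (u v : V) : 
    S.preference N u v ≤ 1 / (4 * N) + 1 / (4 * N) ^ 2 + 1 / (4 * N) ^ 3 := by
  unfold preference
  have : 0 < 4 * N := by linarith
  gcongr <;> split_ifs <;> first | exact le_rfl | positivity

/-- The three scales of the preferences. -/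
theorem scales {N : ℝ} (hN : 1 ≤ N) : ∃ θ φ ψ : ℝ, 1 / (4 * N) = θ ∧ 1 / (4 * N) ^ 2 = φ ∧
    1 / (4 * N) ^ 3 = ψ ∧ 0 < ψ ∧ 4 * N * ψ = φ ∧ 4 * N * φ = θ ∧ 4 * N * θ = 1 ∧
    4 * ψ ≤ φ ∧ 4 * φ ≤ θ ∧ 4 * θ ≤ 1 := by
  have h : 0 < 4 * N := by linarith
  have aux : ∀ x y : ℝ, 0 < x → 4 * N * x = y → 4 * x ≤ y := by
    intro x y hx hxy
    nlinarith
  have h1 : 4 * N * (1 / (4 * N) ^ 3) = 1 / (4 * N) ^ 2 := by field_simp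
  have h2 : 4 * N * (1 / (4 * N) ^ 2) = 1 / (4 * N) := by field_simp
  have h3 : 4 * N * (1 / (4 * N)) = 1 := by field_simp
  exact ⟨_, _, _, rfl, rfl, rfl, by positivity, h1, h2, h3, aux _ _ (by positivity) h1,
    aux _ _ (by positivity) h2, aux _ _ (by positivity) h3⟩

theorem neg_one_le_weight {N : ℝ} (hN : 1 ≤ N) (u v : V) : -1 ≤ S.weight N u v := by
  have h1 := S.preference_nonneg N hN u v
  have h2 := S.preference_le N hN v u
  obtain ⟨θ, φ, ψ, e1, e2, e3, h⟩ := scales hN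
  rw [e1, e2, e3] at h2
  unfold weight
  split_ifs <;> linarith

end Weight

/-! ### Counting at a last vertex whose class is a path. -/

section Count

variable {N : ℝ}

/-- The missing edges `fw` with a successor. -/
def activeN (D : OrientedGraph V) (f : V) : Set V := {w | D.missingGraph.Adj f w ∧ D.HasSucc f w}

/-- The missing edges `fw` without a successor. -/
def sinkN (D : OrientedGraph V) (f : V) : Set V := {w | D.missingGraph.Adj f w ∧ ¬ D.HasSucc f w}

/-- The unreached vertices outside `X` that are treated as bad for `f`. -/
def badSet (D : OrientedGraph V) (f : V) (X : Set V) : Set V :=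
  {b | D.Unreached f b ∧ b ∉ X ∧ (b ∈ D.inN f ∨ b ∈ sinkN D f)}

/-- The unreached vertices that are not bad. -/
def spareSet (D : OrientedGraph V) (f : V) (X : Set V) : Set V :=
  {b | D.Unreached f b ∧ ((b ∈ X ∧ (b ∈ D.inN f ∨ b ∈ sinkN D f)) ∨ b ∈ activeN D f)}

theorem not_mem_activeN_of_mem_badSet {f b : V} {X : Set V} (h : b ∈ badSet D f X) :
    b ∉ activeN D f := by
  intro h1
  rcases h.2.2 with h2 | h2
  · exact h1.1.2.2 h2
  · exact h2.2 h1.2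

/-- By `loses_or_first`, a missing edge `cu` that follows no missing edge at `f` is the first edge
of its path, directed from `c`. -/
theorem weight_out {f c u : V} (hT : S.T f) (hc : D.Unreached f c) (hu : D.Adj f u)
    (h : ¬ ∃ p, D.missingGraph.Adj f p ∧ D.missingGraph.Adj u c ∧ D.Loses f p u c) :
    S.weight N c u = 1 := by
  have h1 := unreached_iff.1 hc
  have hne : c ≠ u := by
    rintro rfl
    exact h1.1 hu
  rcases D.missing_or_adj hne with h2 | h2 | h2
  · exact S.weight_of_adj N h2
  · exact absurd h2 (h1.2 u hu)
  · rcases S.loses_or_first (Or.inl hT) hu hc h2 with ⟨p, h3, h4⟩ | h3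
    · exact absurd ⟨p, h3, h2.symm, h4⟩ h
    · exact S.weight_of_first N h3

/-- An arc `u → c` would make `c` the unreached end of a successor of `fu`, by
`HasSucc.exists_loses`. So `cu` is an arc from `c` or a missing edge in the class of `f`, where
preferences decide. -/
theorem le_weight_active {f c u : V} {X : Set V} {r : ℝ} (hT : S.T f) (hc : c ∈ badSet D f X)
    (hu : u ∈ activeN D f) (h : ¬ ∃ x, D.missingGraph.Adj x c ∧ D.Loses f u x c) (hr : r ≤ 1)
    (hA : ¬ S.A u c) (hp : S.R f c → r ≤ S.preference N c u - S.preference N u c) :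
    r ≤ S.weight N c u := by
  have hne : c ≠ u := by
    rintro rfl
    exact not_mem_activeN_of_mem_badSet hc hu
  rcases D.missing_or_adj hne with h2 | h2 | h2
  · rwa [S.weight_of_adj N h2]
  · exact absurd (hu.2.exists_loses h2 hc.1) h
  · have hR := S.equiv.trans (S.rel_of_missing hu.1) (S.equiv.symm (S.rel_of_missing h2))
    exact S.le_weight N hr h2 (S.path_congr hR hT) hA (hp hR)

variable [Fintype V]

/-- Both sides count the vertices other than `f` that are neither out-neighbours of `f` nor bad. -/
theorem ncard_count (f : V) (X : Set V) :
    ((D.inN f ∪ sinkN D f) \ badSet D f X).ncard + (activeN D f).ncard =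
      (D.secondOutN f).ncard + (spareSet D f X).ncard := by
  have h1 : Disjoint ((D.inN f ∪ sinkN D f) \ badSet D f X) (activeN D f) := by
    rw [Set.disjoint_left]
    rintro u ⟨hu | hu, -⟩ h
    · exact h.1.2.2 hu
    · exact hu.2 h.2
  have h2 : Disjoint (D.secondOutN f) (spareSet D f X) := by
    rw [Set.disjoint_left]
    rintro u hu h
    exact h.1 (Or.inr hu)
  rw [← Set.ncard_union_eq h1 (Set.toFinite _) (Set.toFinite _),
    ← Set.ncard_union_eq h2 (Set.toFinite _) (Set.toFinite _)]
  congr 1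
  ext u
  simp only [Set.mem_union, Set.mem_sdiff, badSet, spareSet, Set.mem_ofPred_eq]
  have h3 : u ∈ D.secondOutN f → ¬ D.Unreached f u := fun h h' => h' (Or.inr h)
  have h4 : u ∈ D.secondOutN f ↔ ¬ D.Unreached f u ∧ u ∉ D.outN f := by
    refine ⟨fun h => ⟨h3 h, h.1⟩, fun h => ?_⟩
    rcases not_not.1 h.1 with h5 | h5
    · exact absurd h5 h.2
    · exact h5
  have h5 : u ∈ D.inN f ∨ u ∈ sinkN D f ∨ u ∈ activeN D f ↔ u ≠ f ∧ u ∉ D.outN f := by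
    constructor
    · rintro (h | h | h)
      · exact ⟨fun e => D.asymm _ _ h (e ▸ h), fun e => D.asymm _ _ h e⟩
      · exact ⟨h.1.ne', h.1.2.1⟩
      · exact ⟨h.1.ne', h.1.2.1⟩
    · rintro ⟨h, h'⟩
      rcases D.missing_or_adj h with h1 | h1 | h1
      · exact Or.inl h1
      · exact absurd h1 h'
      · by_cases h2 : D.HasSucc f u
        · exact Or.inr (Or.inr ⟨h1.symm, h2⟩)
        · exact Or.inr (Or.inl ⟨h1.symm, h2⟩)
  have h6 : u ∈ D.secondOutN f → u ≠ f := by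
    rintro ⟨-, w, hw, hw'⟩ rfl
    exact D.asymm _ _ hw hw'
  tauto

/-- The counting argument at the last vertex `f` of an order of maximal weight. -/
theorem snp_of_last (hN : 1 ≤ N) {q : V → ℝ} (hq : IsMaxOrder (S.weight N) q) {f : V}
    (hf : ∀ v, q v ≤ q f) (X : Set V) (h : V → ℝ) (k : ℤ)
    (hout : ∀ u, D.Adj f u → h u ≤ 1) (hact : ∀ u ∈ activeN D f, h u ≤ S.weight N f u)
    (hbad : ∀ b ∈ badSet D f X, ∀ u, D.Adj f u ∨ u ∈ activeN D f → h u ≤ S.weight N b u)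
    (hsum : ((D.outN f).ncard : ℝ) - k - 1 < ∑ u with D.Adj f u ∨ u ∈ activeN D f, h u)
    (hk : ((spareSet D f X).ncard : ℤ) + k ≤ (activeN D f).ncard) : D.SNP f := by
  -- The value `-1` is a lower bound for every weight, so the remaining vertices that are not bad
  -- are simply counted.
  set g : V → ℝ := fun u => if D.Adj f u ∨ u ∈ activeN D f then h u else -1 with hg
  have key := hq.sum_le_zero (S.weight_skew N) (F := {f}) (B := badSet D f X) (f := f) rfl
    (by rintro x rfl u -; rfl) hf
    (by rintro b - u rfl hub; exact absurd hub (not_lt.2 (hf b)))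
    (g := g)
    (by
      intro u huf hub
      by_cases h1 : D.Adj f u
      · simpa [hg, h1, S.weight_of_adj N h1] using hout u h1
      by_cases h2 : u ∈ activeN D f
      · simpa [hg, h2] using hact u h2
      · simpa [hg, h1, h2] using S.neg_one_le_weight hN f u)
    (by
      intro b hb u huf hub
      by_cases h1 : D.Adj f u ∨ u ∈ activeN D f
      · simpa only [hg, if_pos h1] using hbad b hb u h1
      · simpa only [hg, if_neg h1] using S.neg_one_le_weight hN b u)
  have key' : ∑ u ∈ (univ.filter fun u => D.Adj f u ∨ u ∈ activeN D f) ∪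
      ((D.inN f ∪ sinkN D f) \ badSet D f X).toFinset, g u ≤ 0 := by
    refine le_of_eq_of_le (Finset.sum_congr ?_ fun _ _ => rfl) key
    symm
    ext u
    simp only [mem_filter, mem_univ, true_and, Set.mem_singleton_iff, mem_union, Set.mem_toFinset,
      Set.mem_sdiff, Set.mem_union]
    constructor
    · rintro ⟨h1, h2⟩
      rcases D.missing_or_adj h1 with h3 | h3 | h3
      · exact Or.inr ⟨Or.inl h3, h2⟩
      · exact Or.inl (Or.inl h3)
      · by_cases h4 : D.HasSucc f u
        · exact Or.inl (Or.inr ⟨h3.symm, h4⟩)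
        · exact Or.inr ⟨Or.inr ⟨h3.symm, h4⟩, h2⟩
    · rintro ((h1 | h1) | ⟨h1 | h1, h2⟩)
      · exact ⟨fun e => D.asymm _ _ h1 (e ▸ h1), fun h2 => h2.1 (Or.inl h1)⟩
      · refine ⟨h1.1.ne', fun h2 => ?_⟩
        rcases h2.2.2 with h3 | h3
        · exact h1.1.2.2 h3
        · exact h3.2 h1.2
      · exact ⟨fun e => D.asymm _ _ h1 (e ▸ h1), h2⟩
      · exact ⟨h1.1.ne', h2⟩
  have hdisj : ∀ u ∈ ((D.inN f ∪ sinkN D f) \ badSet D f X).toFinset,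
      ¬ (D.Adj f u ∨ u ∈ activeN D f) := by
    intro u hu
    rw [Set.mem_toFinset] at hu
    rcases hu.1 with h1 | h1
    · rintro (h2 | h2)
      · exact D.asymm _ _ h1 h2
      · exact h2.1.2.2 h1
    · rintro (h2 | h2)
      · exact h1.1.2.1 h2
      · exact h1.2 h2.2
  rw [Finset.sum_union] at key'
  swap
  · rw [Finset.disjoint_right]
    intro u hu hu'
    exact hdisj u hu (by simpa using hu')
  have e1 : ∑ u with D.Adj f u ∨ u ∈ activeN D f, g u
      = ∑ u with D.Adj f u ∨ u ∈ activeN D f, h u :=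
    Finset.sum_congr rfl fun u hu => if_pos (by simpa using hu)
  have e2 : ∑ u ∈ ((D.inN f ∪ sinkN D f) \ badSet D f X).toFinset, g u
      = ∑ u ∈ ((D.inN f ∪ sinkN D f) \ badSet D f X).toFinset, (-1 : ℝ) :=
    Finset.sum_congr rfl fun u hu => if_neg (hdisj u hu)
  rw [e1, e2, Finset.sum_const, ← Set.ncard_eq_toFinset_card', nsmul_eq_mul] at key'
  have h1 : ((D.outN f).ncard : ℝ) - k - 1
      < (((D.inN f ∪ sinkN D f) \ badSet D f X).ncard : ℝ) := by linarith
  -- Integrality turns this strict bound into a gain of a whole unit.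
  have h2 : ((D.outN f).ncard : ℤ) - k - 1
      < (((D.inN f ∪ sinkN D f) \ badSet D f X).ncard : ℤ) := by exact_mod_cast h1
  have h3 := ncard_count (D := D) f X
  unfold SNP
  omega

/-- A lower bound for the sum in the counting argument. -/
theorem sum_active (f a b : V) (α β ε : ℝ) (hε : 0 ≤ ε)
    (ha : a ∈ activeN D f ∨ α = 0) (hb : D.Adj f b ∨ b ∈ activeN D f ∨ β = 0) :
    ((D.outN f).ncard : ℝ) + α + β - ε * Fintype.card V ≤
      ∑ u with D.Adj f u ∨ u ∈ activeN D f, ((if D.Adj f u then 1 else -ε) +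
        (if u = a then α else 0) + if u = b then β else 0) := by
  have h1 : ((D.outN f).ncard : ℝ) - ε * Fintype.card V ≤
      ∑ u with D.Adj f u ∨ u ∈ activeN D f, (if D.Adj f u then 1 else -ε) := by
    rw [Finset.sum_ite, Finset.sum_const, Finset.sum_const, nsmul_eq_mul, nsmul_eq_mul]
    have e1 : (D.outN f).ncard = ({x ∈ univ.filter fun u => D.Adj f u ∨ u ∈ activeN D f |
        D.Adj f x} : Finset V).card := by
      rw [Set.ncard_eq_toFinset_card']
      congr 1
      ext u
      simp only [Set.mem_toFinset, mem_filter, mem_univ, true_and]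
      exact ⟨fun h => ⟨Or.inl h, h⟩, fun h => h.2⟩
    rw [← e1]
    have e2 : ((({x ∈ univ.filter fun u => D.Adj f u ∨ u ∈ activeN D f |
        ¬ D.Adj f x} : Finset V).card : ℕ) : ℝ) ≤ Fintype.card V := by
      exact_mod_cast Finset.card_le_univ _
    nlinarith
  rw [Finset.sum_add_distrib, Finset.sum_add_distrib, Finset.sum_ite_eq', Finset.sum_ite_eq']
  have h2 : (if a ∈ univ.filter fun u => D.Adj f u ∨ u ∈ activeN D f then α else 0) = α := by
    rcases ha with ha | ha
    · simp [ha]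
    · simp [ha]
  have h3 : (if b ∈ univ.filter fun u => D.Adj f u ∨ u ∈ activeN D f then β else 0) = β := by
    rcases hb with hb | hb | hb
    · simp [hb]
    · simp [hb]
    · simp [hb]
  rw [h2, h3]
  linarith

/-- The test function is `1` on out-neighbours and `-ε` on active vertices, corrected by `α` at `a`
and by `β` at `b`. The integer `k` is the guaranteed surplus of active over spare vertices; by
rounding, the weights only have to make `hsum` strict. -/
theorem snp_of_adjusted (hN : 1 ≤ N) {q : V → ℝ} (hq : IsMaxOrder (S.weight N) q) {f : V}
    (hf : ∀ v, q v ≤ q f) (X : Set V) (a b : V) (α β ε : ℝ) (k : ℤ) (hε : 0 ≤ ε)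
    (ha : a ∈ activeN D f ∨ α = 0) (hb : D.Adj f b ∨ b ∈ activeN D f ∨ β = 0)
    (hβ : D.Adj f b → β ≤ 0)
    (hact : ∀ u ∈ activeN D f, -ε + (if u = a then α else 0) + (if u = b then β else 0)
      ≤ S.weight N f u)
    (hbo : ∀ c ∈ badSet D f X, ∀ u, D.Adj f u → 1 + (if u = b then β else 0) ≤ S.weight N c u)
    (hba : ∀ c ∈ badSet D f X, ∀ u ∈ activeN D f,
      -ε + (if u = a then α else 0) + (if u = b then β else 0) ≤ S.weight N c u)
    (hsum : ε * Fintype.card V < α + β + k + 1)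
    (hk : ((spareSet D f X).ncard : ℤ) + k ≤ (activeN D f).ncard) : D.SNP f := by
  have h0 : ∀ u, D.Adj f u → (if u = a then α else 0) = 0 := by
    intro u hu
    split_ifs with h
    · rcases ha with ha | ha
      · exact absurd (h ▸ hu) ha.1.2.1
      · exact ha
    · rfl
  have h1 : ∀ u ∈ activeN D f, ¬ D.Adj f u := fun u hu => hu.1.2.1
  refine S.snp_of_last hN hq hf X (fun u => (if D.Adj f u then 1 else -ε) +
    (if u = a then α else 0) + if u = b then β else 0) k ?_ ?_ ?_ ?_ hk
  · intro u hu
    simp only [hu, if_true, h0 u hu]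
    split_ifs with h
    · have := hβ (h ▸ hu); linarith
    · linarith
  · intro u hu
    simpa only [h1 u hu, if_false] using hact u hu
  · intro c hc u hu
    rcases hu with hu | hu
    · simpa only [hu, if_true, h0 u hu, add_zero] using hbo c hc u hu
    · simpa only [h1 u hu, if_false] using hba c hc u hu
  · have := sum_active (D := D) f a b α β ε hε ha hb
    linarith

variable {S} in
theorem ncard_succs_le_active {f : V} (hT : S.T f) :
    (succs (D := D) f Set.univ).ncard ≤ (activeN D f).ncard := by
  refine (S.ncard_succs_le hT Set.univ).trans (le_of_eq ?_)
  congr 1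
  ext w
  simp [activeN]

/-- The only full unit that can be lost comes from a first edge `ac` with `a` active at `f`: its
head `c` has weight `-1` towards `a` and cannot serve as a bad vertex. The largest preference, for
pairs directed into `a`, makes up for it. -/
theorem snp_of_no_active_first (hN : Fintype.card V + 1 ≤ N) {q : V → ℝ}
    (hq : IsMaxOrder (S.weight N) q) {f : V} (hf : ∀ v, q v ≤ q f) (hT : S.T f)
    (H : ∀ a, S.A a f → ¬ D.HasSucc f a) : D.SNP f := by
  have hn : (0 : ℝ) ≤ Fintype.card V := by positivity
  have hN1 : 1 ≤ N := by linarith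
  obtain ⟨θ, φ, ψ, e1, e2, e3, hψ, s1, s2, s3, t1, t2, t3⟩ := scales hN1
  have n1 : ψ * Fintype.card V ≤ φ / 4 := by nlinarith
  have n2 : φ * Fintype.card V ≤ θ / 4 := by nlinarith
  have n3 : θ * Fintype.card V ≤ 1 / 4 := by nlinarith
  have pnn := S.preference_nonneg N hN1
  have ple : ∀ u v, S.preference N u v ≤ θ + φ + ψ := by
    rw [← e1, ← e2, ← e3]; exact S.preference_le N hN1
  have ple' : ∀ u v, (∀ d, ¬ S.A v d) → S.preference N u v ≤ φ + ψ := by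
    intro u v h
    unfold preference
    rw [e1, e2, e3, if_neg (by simpa using h)]
    split_ifs <;> linarith
  have pge : ∀ u v d, S.A v d → θ ≤ S.preference N u v := by
    intro u v d h
    unfold preference
    rw [e1, e2, e3, if_pos ⟨d, h⟩]
    split_ifs <;> linarith
  by_cases h : ∃ a c, S.A a c ∧ a ∈ activeN D f
  · obtain ⟨a, c, hA, ha⟩ := h
    have hfa := S.rel_of_missing ha.1
    have huniq : ∀ a' c', S.A a' c' → S.R f a' → a' = a ∧ c' = c := fun a' c' h h' =>
      S.first_unique h hA (S.equiv.trans (S.equiv.symm h') hfa)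
    refine S.snp_of_adjusted hN1 hq hf
      (succs (D := D) f Set.univ ∪ {b | ∃ a, S.A a b ∧ a ∈ activeN D f}) a f θ 0 (φ + ψ) (-1)
      (by linarith) (Or.inl ha) (Or.inr (Or.inr rfl)) (fun _ => le_rfl) ?_ ?_ ?_ ?_ ?_
    · intro u hu
      refine S.le_weight N ?_ hu.1 hT (fun h => H u h hu.2) ?_
      · split_ifs <;> linarith
      · have h1 := ple' u f fun d hd => by
          have h2 := (huniq f d hd (S.equiv.refl f)).1
          rw [h2] at ha
          exact ha.1.ne rfl
        have h2 := pnn f u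
        split_ifs with h3
        · have := pge f u c (h3 ▸ hA); linarith
        · have := pge f u c (h3 ▸ hA); linarith
        all_goals linarith
    · intro b hb u hu
      rw [S.weight_out hT hb.1 hu]
      · simp
      · rintro ⟨p, h1, h2, h3⟩
        exact hb.2.1 (Or.inl ⟨p, trivial, u, h1, h2, h3⟩)
    · intro b hb u hu
      refine S.le_weight_active hT hb hu ?_ ?_ ?_ fun hR => ?_
      · rintro ⟨x, h1, h2⟩
        exact hb.2.1 (Or.inl ⟨u, trivial, x, hu.1, h1, h2⟩)
      · split_ifs <;> linarith
      · exact fun h => hb.2.1 (Or.inr ⟨u, h, hu⟩)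
      · have h1 := ple' u b fun d hd => by
          have h2 := (huniq b d hd hR).1
          exact not_mem_activeN_of_mem_badSet hb (h2 ▸ ha)
        have h2 := pnn b u
        split_ifs with h3
        · have := pge b u c (h3 ▸ hA); linarith
        · have := pge b u c (h3 ▸ hA); linarith
        all_goals linarith
    · push_cast
      nlinarith
    -- At most one of `a` and `c` is spare outside `succs`: for `a` this forces `f → c`, so that `c`
    -- is reached.
    · have h1 : spareSet D f (succs (D := D) f Set.univ ∪ {b | ∃ a, S.A a b ∧ a ∈ activeN D f}) ⊆
          insert (if D.Unreached f c then c else a) (succs (D := D) f Set.univ) := by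
        rintro b ⟨hb, ⟨h1 | ⟨a', h1, h2⟩, -⟩ | h1⟩
        · exact Or.inr h1
        · left
          obtain ⟨rfl, rfl⟩ := huniq a' b h1 (S.rel_of_missing h2.1)
          rw [if_pos hb]
        · rcases S.mem_succs_or_first hT h1.1 h1.2 hb with h2 | ⟨x, h2, h3⟩
          · exact Or.inr h2
          · left
            obtain ⟨rfl, rfl⟩ := huniq b x h2 (S.rel_of_missing h1.1)
            rw [if_neg]
            exact fun h => (unreached_iff.1 h).1 h3
      have h2 := Set.ncard_le_ncard h1 (Set.toFinite _)
      have h3 := Set.ncard_insert_le (if D.Unreached f c then c else a) (succs (D := D) f Set.univ)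
      have h4 := ncard_succs_le_active hT
      omega
  · push Not at h
    refine S.snp_of_adjusted hN1 hq hf (succs (D := D) f Set.univ) f f 0 0 (θ + φ + ψ) 0
      (by linarith) (Or.inr rfl) (Or.inr (Or.inr rfl)) (fun _ => le_rfl) ?_ ?_ ?_ ?_ ?_
    · intro u hu
      refine S.le_weight N ?_ hu.1 hT (fun h => H u h hu.2) ?_
      · split_ifs <;> linarith
      · have h1 := ple u f
        have h2 := pnn f u
        split_ifs <;> linarith
    · intro b hb u hu
      rw [S.weight_out hT hb.1 hu]
      · simp
      · rintro ⟨p, h1, h2, h3⟩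
        exact hb.2.1 ⟨p, trivial, u, h1, h2, h3⟩
    · intro b hb u hu
      refine S.le_weight_active hT hb hu ?_ ?_ ?_ fun hR => ?_
      · rintro ⟨x, h1, h2⟩
        exact hb.2.1 ⟨u, trivial, x, hu.1, h1, h2⟩
      · split_ifs <;> linarith
      · exact fun h1 => h _ _ h1 hu
      · have h1 := ple u b
        have h2 := pnn b u
        split_ifs <;> linarith
    · push_cast
      nlinarith
    · have h1 : spareSet D f (succs (D := D) f Set.univ) ⊆ succs (D := D) f Set.univ := by
        rintro b ⟨hb, ⟨h1, -⟩ | h1⟩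
        · exact h1
        · rcases S.mem_succs_or_first hT h1.1 h1.2 hb with h2 | ⟨x, h2, h3⟩
          · exact h2
          · exact absurd h1 (h b x h2)
      have h2 := Set.ncard_le_ncard h1 (Set.toFinite _)
      have h4 := ncard_succs_le_active hT
      omega

end Count

end PathStructure

end OrientedGraph

/-! ### The last vertex as head of a first edge that has a successor. -/

namespace OrientedGraph

variable {V : Type*}

namespace PathStructure

variable {D : OrientedGraph V} (S : D.PathStructure)

section Count

variable {N : ℝ} [Fintype V]

/-- Here `f` has weight `-1` towards the active vertex `a`, a loss of one unit. It is recovered at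
the successor of `fa`, with ends `b₂` (an out-neighbour of `f`) and `a₂` (unreached from `f`), in a
way depending on the role of `a₂`. -/
theorem snp_of_last_of_active_first (hN : Fintype.card V + 1 ≤ N) {q : V → ℝ}
    (hq : IsMaxOrder (S.weight N) q) {f : V} (hf : ∀ v, q v ≤ q f) (hT : S.T f)
    {a : V} (hA : S.A a f) (hs : D.HasSucc f a) : D.SNP f := by
  have hn : (0 : ℝ) ≤ Fintype.card V := by positivity
  have hN1 : 1 ≤ N := by linarith
  obtain ⟨θ, φ, ψ, e1, e2, e3, hψ, s1, s2, s3, t1, t2, t3⟩ := scales hN1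
  have n1 : ψ * Fintype.card V ≤ φ / 4 := by nlinarith
  have n2 : φ * Fintype.card V ≤ θ / 4 := by nlinarith
  have n3 : θ * Fintype.card V ≤ 1 / 4 := by nlinarith
  have pnn := S.preference_nonneg N hN1
  have ple : ∀ u v, S.preference N u v ≤ θ + φ + ψ := by
    rw [← e1, ← e2, ← e3]; exact S.preference_le N hN1
  have ple' : ∀ u v, (∀ d, ¬ S.A v d) → ¬ S.IsSecond u v → S.preference N u v ≤ ψ := by
    intro u v h h'
    unfold preference
    rw [e1, e2, e3, if_neg (by simpa using h), if_neg h']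
    split_ifs <;> linarith
  have ple0 : ∀ u v, (∀ d, ¬ S.A v d) → ¬ S.IsSecond u v → (∀ d, ¬ S.IsSecond v d) →
      S.preference N u v ≤ 0 := by
    intro u v h h' h''
    unfold preference
    rw [if_neg (by simpa using h), if_neg h', if_neg (by simpa using h'')]
    simp
  have pge : ∀ u v d, S.IsSecond v d → ψ ≤ S.preference N u v := by
    intro u v d h
    unfold preference
    rw [e1, e2, e3, if_pos (c := ∃ b, S.IsSecond v b) ⟨d, h⟩]
    split_ifs <;> linarith
  have pge' : ∀ u v, S.IsSecond u v → φ ≤ S.preference N u v := by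
    intro u v h
    unfold preference
    rw [e1, e2, e3, if_pos h]
    split_ifs <;> linarith
  have hfa := (S.first_missing hA).symm
  have haact : a ∈ activeN D f := ⟨hfa, hs⟩
  have huniq : ∀ a' c', S.A a' c' → S.R f a' → a' = a ∧ c' = f := fun a' c' h h' =>
    S.first_unique h hA (S.equiv.trans (S.equiv.symm h') (S.rel_of_missing hfa))
  have hnotfirst : ∀ d, ¬ S.A f d := fun d hd =>
    hfa.ne (huniq f d hd (S.equiv.refl f)).1
  obtain ⟨b₂, a₂, hba, hl⟩ := hs
  obtain ⟨hfb₂, hfa₂, haa₂, hab₂⟩ := loses_iff.1 hl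
  have hRa₂ : S.R f a₂ := S.rel_of_loses hfa hba hl
  have hRb₂ : S.R f b₂ := S.equiv.trans hRa₂ (S.equiv.symm (S.rel_of_missing hba))
  have hTa : S.T a := S.path_congr (S.rel_of_missing hfa) hT
  have hsec : S.IsSecond a₂ b₂ := ⟨a, f, hA, hba.symm, hl.symm⟩
  have hsecu : ∀ u v, S.R f u → S.IsSecond u v → u = a₂ ∧ v = b₂ := by
    rintro u v hR ⟨a', c', h1, h2, h3⟩
    have h4 := S.rel_of_loses (S.first_missing h1) h2 h3
    have h5 : S.R f a' := S.equiv.trans hR (S.equiv.trans (S.rel_of_missing h2) (S.equiv.symm h4))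
    obtain ⟨rfl, rfl⟩ := huniq a' c' h1 h5
    exact S.loses_unique_right hTa hfa.symm h2 hba.symm h3 hl.symm
  have hne₁ : f ≠ b₂ := fun h => D.asymm _ _ hfb₂ (h ▸ hfb₂)
  have hne₂ : f ≠ a₂ := by
    rintro rfl
    exact hfa.2.2 haa₂
  have hne₃ : a ≠ a₂ := fun h => D.asymm _ _ haa₂ (h ▸ haa₂)
  have hsecf : ∀ d, ¬ S.IsSecond f d := fun d hd => hne₂ (hsecu f d (S.equiv.refl f) hd).1
  have hbadA : ∀ X, ∀ c ∈ badSet D f X, S.R f c → ∀ d, ¬ S.A c d := fun X c hc hR d hd =>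
    not_mem_activeN_of_mem_badSet hc ((huniq c d hd hR).1 ▸ haact)
  have hbadf : ∀ X, ∀ c ∈ badSet D f X, c ≠ f := by
    rintro X c hc rfl
    rcases hc.2.2 with h | h
    · exact D.asymm _ _ h h
    · exact h.1.ne rfl
  have hbadb₂ : ∀ X, ∀ c ∈ badSet D f X, c ≠ b₂ := by
    rintro X c hc rfl
    exact (unreached_iff.1 hc.1).1 hfb₂
  have hnA : ∀ X, ∀ c ∈ badSet D f X, ∀ u ∈ activeN D f, ¬ S.A u c := fun X c hc u hu h =>
    hbadf X c hc (huniq u c h (S.rel_of_missing hu.1)).2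
  have hspare : ∀ X, spareSet D f X ⊆ X ∪ succs (D := D) f Set.univ := by
    rintro X b ⟨hb, ⟨h1, -⟩ | h1⟩
    · exact Or.inl h1
    · rcases S.mem_succs_or_first hT h1.1 h1.2 hb with h2 | ⟨x, h2, h3⟩
      · exact Or.inr h2
      · exact absurd ((huniq b x h2 (S.rel_of_missing h1.1)).2 ▸ h3) fun h => D.asymm _ _ h h
  have hsplit : succs (D := D) f Set.univ ⊆ insert a₂ (succs (D := D) f {a}ᶜ) := by
    rintro b ⟨w, -, x, h1, h2, h3⟩
    by_cases hw : w = a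
    · subst hw
      exact Or.inl (S.loses_unique_right hT h1 h2 hba h3 hl).2
    · exact Or.inr ⟨w, hw, x, h1, h2, h3⟩
  have hactf : ∀ u ∈ activeN D f, u ≠ a → ∀ r ≤ 1, r ≤ S.preference N f u →
      r ≤ S.weight N f u := by
    intro u hu hua r hr hr'
    refine S.le_weight N hr hu.1 hT (fun h => hua (huniq u f h (S.rel_of_missing hu.1)).1) ?_
    have := ple0 u f hnotfirst (fun h => ?_) hsecf
    · linarith
    · exact hne₁ (hsecu u f (S.rel_of_missing hu.1) h).2
  have hcard : (succs (D := D) f {a}ᶜ).ncard + 1 ≤ (activeN D f).ncard := by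
    have h1 := S.ncard_succs_le hT {a}ᶜ
    have h2 : {w | w ∈ ({a}ᶜ : Set V) ∧ D.missingGraph.Adj f w ∧ D.HasSucc f w}
        = activeN D f \ {a} := by
      ext w
      simp [activeN, and_comm]
    rw [h2, Set.ncard_sdiff_singleton_of_mem haact] at h1
    have h3 : 0 < (activeN D f).ncard := (Set.ncard_pos (Set.toFinite _)).2 ⟨a, haact⟩
    omega
  -- If `a₂` is also produced by another active vertex, then `a` is not needed to pay for it, and
  -- this surplus `k = 1` covers the loss at `a`.
  by_cases hc₁ : a₂ ∈ succs (D := D) f {a}ᶜ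
  · refine S.snp_of_adjusted hN1 hq hf (succs (D := D) f {a}ᶜ) a f (-1) 0 (θ + φ + ψ) 1
      (by linarith) (Or.inl haact) (Or.inr (Or.inr rfl)) (fun _ => le_rfl) ?_ ?_ ?_ ?_ ?_
    · intro u hu
      by_cases hua : u = a
      · have := S.neg_one_le_weight hN1 f u
        rw [if_pos hua]
        split_ifs <;> linarith
      · rw [if_neg hua]
        refine hactf u hu hua _ ?_ ?_
        · split_ifs <;> linarith
        · have := pnn f u
          split_ifs <;> linarith
    · intro b hb u hu
      rw [S.weight_out hT hb.1 hu]
      · simp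
      · rintro ⟨p, h1, h2, h3⟩
        rcases hsplit ⟨p, trivial, u, h1, h2, h3⟩ with h4 | h4
        · exact hb.2.1 (h4 ▸ hc₁)
        · exact hb.2.1 h4
    · intro b hb u hu
      by_cases hua : u = a
      · have := S.neg_one_le_weight hN1 b u
        rw [if_pos hua]
        split_ifs <;> linarith
      · rw [if_neg hua]
        refine S.le_weight_active hT hb hu ?_ ?_ (hnA _ b hb u hu) fun hR => ?_
        · rintro ⟨x, h1, h2⟩
          exact hb.2.1 ⟨u, hua, x, hu.1, h1, h2⟩
        · split_ifs <;> linarith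
        · have h1 := ple u b
          have h2 := pnn b u
          split_ifs <;> linarith
    · push_cast
      nlinarith
    · have h1 : spareSet D f (succs (D := D) f {a}ᶜ) ⊆ succs (D := D) f {a}ᶜ := by
        intro b hb
        rcases hspare _ hb with h | h
        · exact h
        · rcases hsplit h with h | h
          · exact h ▸ hc₁
          · exact h
      have h2 := Set.ncard_le_ncard h1 (Set.toFinite _)
      omega
  -- If `a₂` is active, the preference `ψ` for pairs directed into it makes the inequality strict
  -- with `k = 0`, and no other error occurs (`ε = 0`).
  by_cases hc₂ : a₂ ∈ activeN D f
  · refine S.snp_of_adjusted hN1 hq hf (succs (D := D) f Set.univ) a a₂ (-1) ψ 0 0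
      le_rfl (Or.inl haact) (Or.inr (Or.inl hc₂))
      (fun h => absurd h (unreached_iff.1 hfa₂).1) ?_ ?_ ?_ ?_ ?_
    · intro u hu
      by_cases hua : u = a
      · have := S.neg_one_le_weight hN1 f u
        rw [if_pos hua, if_neg (hua ▸ hne₃)]
        linarith
      · rw [if_neg hua]
        refine hactf u hu hua _ ?_ ?_
        · split_ifs <;> linarith
        · have := pnn f u
          split_ifs with h
          · have := pge f u b₂ (h ▸ hsec); linarith
          · linarith
    · intro b hb u hu
      rw [S.weight_out hT hb.1 hu]
      · rw [if_neg]
        · simp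
        · rintro rfl
          exact (unreached_iff.1 hfa₂).1 hu
      · rintro ⟨p, h1, h2, h3⟩
        exact hb.2.1 ⟨p, trivial, u, h1, h2, h3⟩
    · intro b hb u hu
      by_cases hua : u = a
      · have := S.neg_one_le_weight hN1 b u
        rw [if_pos hua, if_neg (hua ▸ hne₃)]
        linarith
      · rw [if_neg hua]
        refine S.le_weight_active hT hb hu ?_ ?_ (hnA _ b hb u hu) fun hR => ?_
        · rintro ⟨x, h1, h2⟩
          exact hb.2.1 ⟨u, trivial, x, hu.1, h1, h2⟩
        · split_ifs <;> linarith
        · have h1 := ple0 u b (hbadA _ b hb hR)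
            (fun h => hbadb₂ _ b hb (hsecu u b (S.rel_of_missing hu.1) h).2)
            (fun d hd => hb.2.1 ((hsecu b d hR hd).1 ▸ ⟨a, trivial, b₂, hfa, hba, hl⟩))
          have h2 := pnn b u
          split_ifs with h
          · have := pge b u b₂ (h ▸ hsec); linarith
          · linarith
    · push_cast
      linarith
    · have h1 : spareSet D f (succs (D := D) f Set.univ) ⊆ succs (D := D) f Set.univ := by
        intro b hb
        rcases hspare _ hb with h | h <;> exact h
      have h2 := Set.ncard_le_ncard h1 (Set.toFinite _)
      have h3 := ncard_succs_le_active (S := S) hT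
      omega
  -- Now `a₂` may be bad, and `a` need not pay for it. The weight from `a₂` to `b₂` is only known to
  -- be at least `φ - ψ`, which costs a second unit at `b₂`, whence `β`. What is left, `φ - ψ`,
  -- exceeds the errors `ψ` over all of `V`.
  · refine S.snp_of_adjusted hN1 hq hf (succs (D := D) f {a}ᶜ) a b₂ (-1) (φ - ψ - 1) ψ 1
      hψ.le (Or.inl haact) (Or.inl hfb₂) (fun _ => by linarith) ?_ ?_ ?_ ?_ ?_
    · intro u hu
      have hub : u ≠ b₂ := by
        rintro rfl
        exact hu.1.2.1 hfb₂
      rw [if_neg hub]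
      by_cases hua : u = a
      · have := S.neg_one_le_weight hN1 f u
        rw [if_pos hua]
        linarith
      · rw [if_neg hua]
        refine hactf u hu hua _ (by linarith) ?_
        have := pnn f u
        linarith
    · intro b hb u hu
      by_cases hub : u = b₂ ∧ b = a₂
      · rw [if_pos hub.1, hub.1, hub.2]
        refine S.le_weight N (by linarith) hba.symm (S.path_congr hRa₂ hT) (fun h => ?_) ?_
        · exact hne₂ (huniq b₂ a₂ h hRb₂).2.symm
        · have h1 := pge' a₂ b₂ hsec
          have h2 := ple' b₂ a₂ (fun d hd => hne₃ (huniq a₂ d hd hRa₂).1.symm)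
            (fun h => hba.ne (hsecu b₂ a₂ hRb₂ h).1)
          linarith
      · rw [S.weight_out hT hb.1 hu]
        · split_ifs <;> linarith
        · rintro ⟨p, h1, h2, h3⟩
          by_cases hp : p = a
          · subst hp
            exact hub (S.loses_unique_right hT h1 h2 hba h3 hl)
          · exact hb.2.1 ⟨p, hp, u, h1, h2, h3⟩
    · intro b hb u hu
      have hub : u ≠ b₂ := by
        rintro rfl
        exact hu.1.2.1 hfb₂
      rw [if_neg hub]
      by_cases hua : u = a
      · have := S.neg_one_le_weight hN1 b u
        rw [if_pos hua]
        linarith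
      · rw [if_neg hua]
        refine S.le_weight_active hT hb hu ?_ (by linarith) (hnA _ b hb u hu) fun hR => ?_
        · rintro ⟨x, h1, h2⟩
          exact hb.2.1 ⟨u, hua, x, hu.1, h1, h2⟩
        · have h1 := ple' u b (hbadA _ b hb hR)
            (fun h => hbadb₂ _ b hb (hsecu u b (S.rel_of_missing hu.1) h).2)
          have h2 := pnn b u
          linarith
    · push_cast
      nlinarith
    · have h1 : spareSet D f (succs (D := D) f {a}ᶜ) ⊆ succs (D := D) f {a}ᶜ := by
        rintro b ⟨hb, h | h⟩
        · exact h.1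
        · rcases hspare (succs (D := D) f {a}ᶜ) ⟨hb, Or.inr h⟩ with h' | h'
          · exact h'
          · rcases hsplit h' with h2 | h2
            · exact absurd (h2 ▸ h) hc₂
            · exact h2
      have h2 := Set.ncard_le_ncard h1 (Set.toFinite _)
      omega

end Count

end PathStructure

end OrientedGraph

/-! ### Whole last vertices and interval classes. -/

namespace OrientedGraph

variable {V : Type*} [Fintype V]

/-- A sum of signs bounds the number of vertices on which the sign is positive. -/
theorem ncard_le_of_sum_sign {P Q : V → Prop} {_ : DecidablePred P} {_ : DecidablePred Q} (W : Set V)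
    (h : ∑ u with P u, (if Q u then (1 : ℝ) else -1) ≤ 0) (hW : ∀ u, P u → ¬ Q u → u ∈ W) :
    {u | P u ∧ Q u}.ncard ≤ W.ncard := by
  rw [Finset.sum_ite, Finset.sum_const, Finset.sum_const, nsmul_eq_mul, nsmul_eq_mul] at h
  have h1 : (univ.filter P).filter Q = {u | P u ∧ Q u}.toFinset := by
    ext u
    simp
  have h2 : ((univ.filter P).filter fun u => ¬ Q u).card ≤ W.ncard := by
    rw [Set.ncard_eq_toFinset_card' W]
    refine Finset.card_le_card fun u hu => ?_
    simp only [mem_filter, mem_univ, true_and] at hu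
    exact Set.mem_toFinset.2 (hW u hu.1 hu.2)
  rw [h1, ← Set.ncard_eq_toFinset_card'] at h
  have h3 : ({u | P u ∧ Q u}.ncard : ℝ) ≤ (W.ncard : ℝ) := by
    have : ((((univ.filter P).filter fun u => ¬ Q u).card : ℕ) : ℝ) ≤ (W.ncard : ℝ) := by
      exact_mod_cast h2
    linarith
  exact_mod_cast h3

/-- A whole feed vertex that does not distinguish the ends of the missing edges has the second
neighbourhood property. -/
theorem snp_of_last_of_isWhole {D : OrientedGraph V} {q : V → ℝ} (hq : IsMaxOrder D.arcWeight q)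
    {f : V} (hf : ∀ v, q v ≤ q f) (hw : D.IsWhole f)
    (hm : ∀ u b, D.missingGraph.Adj u b → D.Adj f u → D.Adj f b) : D.SNP f := by
  have hneg : ∀ u v, (-1 : ℝ) ≤ D.arcWeight u v := by
    intro u v
    unfold arcWeight
    split_ifs <;> norm_num
  have key := hq.sum_le_zero D.arcWeight_skew (F := {f}) (B := {b | D.Adj b f ∧ D.Unreached f b})
    (f := f) rfl (by rintro x rfl u -; rfl) hf
    (by rintro b - u rfl hub; exact absurd hub (not_lt.2 (hf b)))
    (g := fun u => if D.Adj f u then 1 else -1)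
    (by
      intro u _ _
      by_cases h : D.Adj f u
      · simp only [h, if_true, arcWeight_of_adj h, le_refl]
      · simpa only [h, if_false] using hneg f u)
    (by
      rintro b ⟨-, hb⟩ u _ _
      by_cases h : D.Adj f u
      · have h1 := unreached_iff.1 hb
        rcases D.missing_or_adj (u := b) (v := u) (fun e => h1.1 (e ▸ h)) with h2 | h2 | h2
        · simp only [h, if_true, arcWeight_of_adj h2, le_refl]
        · exact absurd h2 (h1.2 u h)
        · exact absurd (hm u b h2.symm h) h1.1
      · simpa only [h, if_false] using hneg b u)
  refine le_trans (Set.ncard_le_ncard ?_ (Set.toFinite _))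
    (ncard_le_of_sum_sign (D.secondOutN f) key ?_)
  · intro u hu
    exact ⟨⟨fun e => D.asymm _ _ hu (e ▸ hu), fun h => D.asymm _ _ hu h.1⟩, hu⟩
  · rintro u ⟨h1, h2⟩ h3
    rcases D.missing_or_adj h1 with h4 | h4 | h4
    · rcases not_not.1 fun h => h2 ⟨h4, h⟩ with h5 | h5
      · exact absurd h5 h3
      · exact h5
    · exact absurd h4 h3
    · exact absurd h4.symm (hw u)

/-- In an interval one may pass from the second neighbourhood property inside to the whole
graph. -/
theorem snp_of_induce {D : OrientedGraph V} {F : Set V} (hF : D.IsInterval F) {f : V} (hf : f ∈ F)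
    (h : (D.outN f \ F).ncard ≤ (D.secondOutN f \ F).ncard) (p : F) (hp : (D.induce F).SNP p) :
    D.SNP p := by
  have hout : ∀ x ∈ F, ∀ y ∈ F, ∀ u ∉ F, D.Adj x u → D.Adj y u := by
    intro x hx y hy u hu hxu
    have : u ∈ D.outN x \ F := ⟨hxu, hu⟩
    rw [(hF x hx y hy).1] at this
    exact this.1
  have e1 : D.outN p = Subtype.val '' (D.induce F).outN p ∪ (D.outN f \ F) := by
    ext u
    constructor
    · intro hu
      by_cases huF : u ∈ F
      · exact Or.inl ⟨⟨u, huF⟩, hu, rfl⟩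
      · exact Or.inr ⟨hout p p.2 f hf u huF hu, huF⟩
    · rintro (⟨v, hv, rfl⟩ | ⟨hu, huF⟩)
      · exact hv
      · exact hout f hf p p.2 u huF hu
  have e2 : Subtype.val '' (D.induce F).secondOutN p ∪ (D.secondOutN f \ F)
      ⊆ D.secondOutN p := by
    rintro u (⟨v, ⟨hv, w, hw, hw'⟩, rfl⟩ | ⟨⟨hu, w, hw, hw'⟩, huF⟩)
    · exact ⟨hv, w, hw, hw'⟩
    · refine ⟨fun h => hu (hout p p.2 f hf u huF h), w, ?_, hw'⟩
      -- A middle vertex inside the interval would force the arc `f → u`.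
      have hwF : w ∉ F := fun hwF => hu (hout w hwF f hf u huF hw')
      exact hout f hf p p.2 w hwF hw
  have hd : ∀ (X : Set F) (Y : Set V), (Subtype.val '' X ∪ (Y \ F)).ncard
      = X.ncard + (Y \ F).ncard := by
    intro X Y
    rw [Set.ncard_union_eq _ (Set.toFinite _) (Set.toFinite _),
      Set.ncard_image_of_injective _ Subtype.val_injective]
    rw [Set.disjoint_left]
    rintro _ ⟨v, -, rfl⟩ h
    exact h.2 v.2
  have h1 := Set.ncard_le_ncard e2 (Set.toFinite _)
  unfold SNP at hp ⊢
  rw [e1, hd]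
  rw [hd] at h1
  omega

/-- With the out-neighbourhood of `p` unchanged, additional arcs can only enlarge its second
out-neighbourhood. -/
theorem SNP.of_le {D D' : OrientedGraph V} {p : V} (h : D.SNP p) (h1 : D'.outN p = D.outN p)
    (hle : ∀ u v, D.Adj u v → D'.Adj u v) : D'.SNP p := by
  refine (le_of_eq (congrArg _ h1)).trans (h.trans (Set.ncard_le_ncard ?_ (Set.toFinite _)))
  rintro u ⟨hu, w, hw, hw'⟩
  refine ⟨fun h => hu ?_, w, hle _ _ hw, hle _ _ hw'⟩
  have : u ∈ D'.outN p := h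
  rwa [h1] at this

namespace PathStructure

variable {D : OrientedGraph V} (S : D.PathStructure) {N : ℝ}

theorem snp_of_path (hN : Fintype.card V + 1 ≤ N) {q : V → ℝ}
    (hq : IsMaxOrder (S.weight N) q) {f : V} (hf : ∀ v, q v ≤ q f) (hT : S.T f) : D.SNP f := by
  by_cases H : ∃ a, S.A a f ∧ D.HasSucc f a
  · obtain ⟨a, hA, hs⟩ := H
    exact S.snp_of_last_of_active_first hN hq hf hT hA hs
  · push Not at H
    exact S.snp_of_no_active_first hN hq hf hT H

/-- The second neighbourhood property outside a component that is not a path. -/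
theorem ncard_outside_le (hN : 1 ≤ N) {q : V → ℝ} (hq : IsMaxOrder (S.weight N) q) {f : V}
    (hf : ∀ v, q v ≤ q f) (hT : ¬ S.T f) :
    (D.outN f \ {u | S.R f u}).ncard ≤ (D.secondOutN f \ {u | S.R f u}).ncard := by
  have hadj : ∀ x u, S.R f x → ¬ S.R f u → D.Adj x u ∨ D.Adj u x := by
    intro x u hx hu
    rcases D.missing_or_adj (u := x) (v := u) (fun e => hu (e ▸ hx)) with h | h | h
    · exact Or.inl h
    · exact Or.inr h
    · exact absurd (S.equiv.trans hx (S.rel_of_missing h)) hu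
  have hneg := S.neg_one_le_weight hN
  have key := hq.sum_le_zero (S.weight_skew N) (F := {u | S.R f u})
    (B := {b | ¬ S.R f b ∧ D.Adj b f ∧ D.Unreached f b}) (f := f) (S.equiv.refl f)
    (by
      intro x hx u hu
      rcases hadj f u (S.equiv.refl f) hu with h | h
      · rw [S.weight_of_adj N h, S.weight_of_adj N (S.out_congr hT hx hu h)]
      · rw [S.weight_skew N, S.weight_skew N f, S.weight_of_adj N h,
          S.weight_of_adj N (S.in_congr hT hx hu h)]) hf
    (by
      rintro b ⟨h1, h2, -⟩ u hu -
      rw [S.weight_of_adj N (S.in_congr hT hu h1 h2)]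
      exact zero_le_one)
    (g := fun u => if D.Adj f u then 1 else -1)
    (by
      intro u _ _
      by_cases h : D.Adj f u
      · simp only [h, if_true, S.weight_of_adj N h, le_refl]
      · simpa only [h, if_false] using hneg f u)
    (by
      rintro b ⟨hR, -, hb⟩ u hu _
      by_cases h : D.Adj f u
      · have h1 := unreached_iff.1 hb
        have h3 : S.weight N b u = 1 := by
          rcases D.missing_or_adj (u := b) (v := u) (fun e => h1.1 (e ▸ h)) with h2 | h2 | h2
          · exact S.weight_of_adj N h2
          · exact absurd h2 (h1.2 u h)
          · rcases S.loses_or_first (Or.inr hR) h hb h2 with ⟨w, h3, h4⟩ | h3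
            · exact absurd (S.rel_of_loses h3 h2.symm h4) hR
            · exact S.weight_of_first N h3
        simp only [h, if_true, h3, le_refl]
      · simpa only [h, if_false] using hneg b u)
  refine le_trans (Set.ncard_le_ncard ?_ (Set.toFinite _))
    (ncard_le_of_sum_sign (D.secondOutN f \ {u | S.R f u}) key ?_)
  · rintro u ⟨hu, hu'⟩
    exact ⟨⟨hu', fun h => D.asymm _ _ hu h.2.1⟩, hu⟩
  · rintro u ⟨h1, h2⟩ h3
    refine ⟨?_, h1⟩
    rcases hadj f u (S.equiv.refl f) h1 with h4 | h4
    · exact absurd h4 h3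
    · rcases not_not.1 fun h => h2 ⟨h1, h4, h⟩ with h5 | h5
      · exact absurd h5 h3
      · exact h5

end PathStructure

end OrientedGraph

/-! ### The classes `J(x)` and the path structure of `D`. -/

namespace OrientedGraph

variable {V : Type*}

/-- Two vertices are in one step if they belong to missing edges that are equal or adjacent in the
dependency digraph. -/
def Step (D : OrientedGraph V) (u v : V) : Prop :=
  ∃ e e' : D.MissingEdge, u ∈ e.1 ∧ v ∈ e'.1 ∧
    (e = e' ∨ D.dependency.Adj e e' ∨ D.dependency.Adj e' e)

/-- The equivalence relation generated by the steps; its classes are the sets `J(x)`. -/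
def Related (D : OrientedGraph V) : V → V → Prop := Relation.ReflTransGen D.Step

variable {D : OrientedGraph V}

theorem Step.symm {u v : V} (h : D.Step u v) : D.Step v u := by
  obtain ⟨e, e', h1, h2, h3⟩ := h
  exact ⟨e', e, h2, h1, h3.elim (fun h => Or.inl h.symm) fun h => Or.inr h.symm⟩

theorem related_equivalence : Equivalence D.Related where
  refl _ := Relation.ReflTransGen.refl
  symm h := by
    induction h with
    | refl => exact Relation.ReflTransGen.refl
    | tail _ hs ih => exact Relation.ReflTransGen.head hs.symm ih
  trans h h' := Relation.ReflTransGen.trans h h'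

/-- The component of the interval graph to which a missing edge belongs. -/
def intervalOf (D : OrientedGraph V) (e : D.MissingEdge) : D.IntervalComponent :=
  D.intervalGraph.connectedComponentMk (D.dependency.toSimpleGraphInclusive.connectedComponentMk e)

theorem depComponent_eq {e e' : D.MissingEdge} (h : D.dependency.Adj e e') :
    D.dependency.toSimpleGraphInclusive.connectedComponentMk e =
      D.dependency.toSimpleGraphInclusive.connectedComponentMk e' := by
  by_cases he : e = e'
  · rw [he]
  · refine SimpleGraph.ConnectedComponent.sound (SimpleGraph.Adj.reachable ?_)
    exact ⟨he, Or.inl h⟩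

theorem mem_K_of_mem {u : V} {e : D.MissingEdge} (h : u ∈ e.1) :
    u ∈ D.K (D.dependency.toSimpleGraphInclusive.connectedComponentMk e) :=
  ⟨e, rfl, h⟩

theorem intervalGraph_mk_eq {u : V} {C C' : D.DepComponent} (h : u ∈ D.K C) (h' : u ∈ D.K C') :
    D.intervalGraph.connectedComponentMk C = D.intervalGraph.connectedComponentMk C' := by
  by_cases hC : C = C'
  · rw [hC]
  · exact SimpleGraph.ConnectedComponent.sound
      (SimpleGraph.Adj.reachable ⟨hC, u, h, h'⟩)

theorem intervalOf_eq {u : V} {e e' : D.MissingEdge} (h : u ∈ e.1) (h' : u ∈ e'.1) :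
    D.intervalOf e = D.intervalOf e' :=
  intervalGraph_mk_eq (mem_K_of_mem h) (mem_K_of_mem h')

theorem mem_KK_iff {u : V} {ξ : D.IntervalComponent} :
    u ∈ D.KK ξ ↔ ∃ e : D.MissingEdge, u ∈ e.1 ∧ D.intervalOf e = ξ := by
  simp only [KK, Set.mem_iUnion, K, exists_prop]
  constructor
  · rintro ⟨C, hC, e, rfl, he⟩
    exact ⟨e, he, hC⟩
  · rintro ⟨e, he, h⟩
    exact ⟨_, h, e, rfl, he⟩

theorem related_of_mem_K {C : D.DepComponent} {x y : V} (hx : x ∈ D.K C) (hy : y ∈ D.K C) :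
    D.Related x y := by
  obtain ⟨e, rfl, hxe⟩ := hx
  obtain ⟨e', he', hye⟩ := hy
  have hr : D.dependency.toSimpleGraphInclusive.Reachable e e' :=
    (SimpleGraph.ConnectedComponent.exact he').symm
  obtain ⟨w⟩ := hr
  clear he'
  induction w generalizing x with
  | nil => exact Relation.ReflTransGen.single ⟨_, _, hxe, hye, Or.inl rfl⟩
  | @cons a b c hab w ih =>
    have hb : b.1.out.1 ∈ b.1 := Sym2.out_fst_mem _
    refine Relation.ReflTransGen.head ⟨a, b, hxe, hb, Or.inr hab.2⟩ (ih hb hye)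

theorem related_of_reachable {C C' : D.DepComponent} (h : D.intervalGraph.Reachable C C')
    {x y : V} (hx : x ∈ D.K C) (hy : y ∈ D.K C') : D.Related x y := by
  obtain ⟨w⟩ := h
  induction w generalizing x with
  | nil => exact related_of_mem_K hx hy
  | cons hab w ih =>
    obtain ⟨-, z, hz, hz'⟩ := hab
    exact related_equivalence.trans (related_of_mem_K hx hz) (ih hz' hy)

theorem related_of_intervalOf_eq {e e' : D.MissingEdge} (h : D.intervalOf e = D.intervalOf e')
    {x y : V} (hx : x ∈ e.1) (hy : y ∈ e'.1) : D.Related x y :=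
  related_of_reachable (SimpleGraph.ConnectedComponent.exact h) (mem_K_of_mem hx) (mem_K_of_mem hy)

theorem exists_mem_of_related {e : D.MissingEdge} {x y : V} (hx : x ∈ e.1) (h : D.Related x y) :
    ∃ e' : D.MissingEdge, y ∈ e'.1 ∧ D.intervalOf e' = D.intervalOf e := by
  induction h with
  | refl => exact ⟨e, hx, rfl⟩
  | tail _ hs ih =>
    obtain ⟨e', h1, h2⟩ := ih
    obtain ⟨e₁, e₂, h3, h4, h5⟩ := hs
    refine ⟨e₂, h4, ?_⟩
    rw [← h2, intervalOf_eq h1 h3]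
    rcases h5 with rfl | h5 | h5
    · rfl
    · exact congrArg D.intervalGraph.connectedComponentMk (depComponent_eq h5).symm
    · exact congrArg D.intervalGraph.connectedComponentMk (depComponent_eq h5)

theorem not_isWhole_of_mem {e : D.MissingEdge} {x : V} (hx : x ∈ e.1) : ¬ D.IsWhole x := by
  intro h
  obtain ⟨y, hy⟩ := hx
  have := e.2
  rw [hy] at this
  exact h y this

theorem exists_missingEdge {x y : V} (h : D.missingGraph.Adj x y) :
    ∃ e : D.MissingEdge, e.1 = s(x, y) :=
  ⟨⟨s(x, y), h⟩, rfl⟩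

/-- The set `J(x)` is the class of `x`. -/
theorem mem_J_iff {x y : V} : y ∈ D.J x ↔ D.Related x y := by
  unfold J
  split_ifs with hw
  · constructor
    · rintro rfl
      exact Relation.ReflTransGen.refl
    · intro h
      rcases Relation.ReflTransGen.cases_head h with rfl | ⟨z, ⟨e, -, hx, -⟩, -⟩
      · rfl
      · exact absurd hw (not_isWhole_of_mem hx)
  · simp only [Set.mem_iUnion, exists_prop, mem_KK_iff]
    constructor
    · rintro ⟨ξ, ⟨e, hx, he⟩, e', hy, he'⟩
      exact related_of_intervalOf_eq (he.trans he'.symm) hx hy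
    · intro h
      simp only [IsWhole, not_forall, not_not] at hw
      obtain ⟨z, hz⟩ := hw
      obtain ⟨e, he⟩ := exists_missingEdge hz
      have hx : x ∈ e.1 := by rw [he]; exact Sym2.mem_mk_left x z
      obtain ⟨e', hy, he'⟩ := exists_mem_of_related hx h
      exact ⟨_, ⟨e, hx, rfl⟩, e', hy, he'⟩

theorem J_congr {x y : V} (h : D.Related x y) : D.J x = D.J y := by
  ext z
  rw [mem_J_iff, mem_J_iff]
  exact ⟨fun h' => related_equivalence.trans (related_equivalence.symm h) h',
    fun h' => related_equivalence.trans h h'⟩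

theorem KK_eq_J {e : D.MissingEdge} {x : V} (hx : x ∈ e.1) : D.KK (D.intervalOf e) = D.J x := by
  ext y
  rw [mem_KK_iff, mem_J_iff]
  constructor
  · rintro ⟨e', hy, he'⟩
    exact related_of_intervalOf_eq he'.symm hx hy
  · intro h
    exact exists_mem_of_related hx h

theorem related_of_missing {u v : V} (h : D.missingGraph.Adj u v) : D.Related u v :=
  Relation.ReflTransGen.single ⟨⟨s(u, v), h⟩, ⟨s(u, v), h⟩, Sym2.mem_mk_left u v,
    Sym2.mem_mk_right u v, Or.inl rfl⟩

theorem dependency_adj_mk {u v x y : V} (h : D.missingGraph.Adj u v) (h' : D.missingGraph.Adj x y) :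
    D.dependency.Adj ⟨s(u, v), h⟩ ⟨s(x, y), h'⟩ ↔ D.Loses u v x y ∨ D.Loses u v y x := by
  constructor
  · rintro ⟨a, b, c, d, h1, h2, h3⟩
    rcases Sym2.eq_iff.1 h1 with ⟨rfl, rfl⟩ | ⟨rfl, rfl⟩ <;>
      rcases Sym2.eq_iff.1 h2 with ⟨rfl, rfl⟩ | ⟨rfl, rfl⟩
    · exact Or.inl h3
    · exact Or.inr h3
    · exact Or.inr h3.symm
    · exact Or.inl h3.symm
  · rintro (h | h)
    · exact ⟨u, v, x, y, rfl, rfl, h⟩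
    · exact ⟨u, v, y, x, rfl, Sym2.eq_swap, h⟩

theorem step_iff {u v : V} : D.Step u v ↔ ∃ x y a b, D.missingGraph.Adj x y ∧
    D.missingGraph.Adj a b ∧ u ∈ s(x, y) ∧ v ∈ s(a, b) ∧ (s(x, y) = s(a, b) ∨
      (D.Loses x y a b ∨ D.Loses x y b a) ∨ (D.Loses a b x y ∨ D.Loses a b y x)) := by
  constructor
  · rintro ⟨⟨e, he⟩, ⟨e', he'⟩, h1, h2, h3⟩
    induction e with
    | _ x y =>
    induction e' with
    | _ a b =>
    refine ⟨x, y, a, b, he, he', h1, h2, h3.imp (congrArg Subtype.val) ?_⟩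
    exact Or.imp (dependency_adj_mk he he').1 (dependency_adj_mk he' he).1
  · rintro ⟨x, y, a, b, he, he', h1, h2, h3⟩
    refine ⟨⟨s(x, y), he⟩, ⟨s(a, b), he'⟩, h1, h2, h3.imp Subtype.ext ?_⟩
    exact Or.imp (dependency_adj_mk he he').2 (dependency_adj_mk he' he).2

theorem related_of_loses {f w x y : V} (hw : D.missingGraph.Adj f w)
    (hx : D.missingGraph.Adj x y) (h : D.Loses f w x y) : D.Related f y :=
  Relation.ReflTransGen.single ⟨⟨s(f, w), hw⟩, ⟨s(x, y), hx⟩, Sym2.mem_mk_left f w,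
    Sym2.mem_mk_right x y, Or.inr (Or.inl ((dependency_adj_mk hw hx).2 (Or.inl h)))⟩

theorem JIsPath.congr {x y : V} (h : D.Related x y) (hx : D.JIsPath x) : D.JIsPath y := by
  unfold JIsPath at hx ⊢
  rwa [← J_congr h]

/-- The listing of the missing edges in a class that is a directed path. -/
theorem JIsPath.exists_index {x : V} (hx : D.JIsPath x) :
    ∃ ι : D.MissingEdge → ℕ, ∀ e e' : D.MissingEdge, (∃ u ∈ e.1, D.Related x u) →
      (∃ u ∈ e'.1, D.Related x u) → (ι e = ι e' → e = e') ∧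
      (D.dependency.Adj e e' ↔ ι e + 1 = ι e') ∧
      (ι e ≠ 0 → ∃ e₀, D.dependency.Adj e₀ e) := by
  obtain ⟨P, ξ, ⟨k, l, hl⟩, hξ, hJ⟩ := hx
  have hP : D.intervalGraph.connectedComponentMk P = ξ := by
    have : P ∈ ξ.supp := by rw [hξ]; rfl
    exact this
  have hmem : ∀ e : D.MissingEdge, (∃ u ∈ e.1, D.Related x u) → e ∈ P.supp := by
    rintro e ⟨u, hu, hxu⟩
    have h1 : u ∈ D.K P := by rw [← hJ, mem_J_iff]; exact hxu
    have h2 : D.dependency.toSimpleGraphInclusive.connectedComponentMk e ∈ ξ.supp := by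
      rw [← hP]
      exact intervalGraph_mk_eq (mem_K_of_mem hu) h1
    rw [hξ] at h2
    exact h2
  classical
  -- The value `0` off `P` is irrelevant: by `hmem`, all missing edges meeting the class lie in `P`.
  refine ⟨fun e => if h : e ∈ P.supp then (l.symm ⟨e, h⟩ : ℕ) else 0, fun e e' he he' => ?_⟩
  replace he := hmem e he
  replace he' := hmem e' he'
  simp only [he, he', dif_pos]
  refine ⟨fun h => ?_, ?_, fun h => ?_⟩
  · have := l.symm.injective (Fin.ext h)
    exact congrArg Subtype.val this
  · rw [← hl]
    simp
  · have h1 := (l.symm ⟨e, he⟩).2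
    refine ⟨(l ⟨(l.symm ⟨e, he⟩ : ℕ) - 1, by omega⟩).1, ?_⟩
    have h2 := (hl ⟨(l.symm ⟨e, he⟩ : ℕ) - 1, by omega⟩ (l.symm ⟨e, he⟩)).2 (by simp; omega)
    simpa using h2

/-- The orientation `uv` of a missing edge is convenient if every in-neighbour of `u` reaches
`v`. -/
def Convenient (D : OrientedGraph V) (u v : V) : Prop := ∀ p, D.Adj p u → ¬ D.Unreached p v

/-- Witnesses against both orientations would be the ends of a missing edge losing to `uv`. -/
theorem convenient_or {u v : V} (h : ¬ D.HasPred u v) : D.Convenient u v ∨ D.Convenient v u := by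
  by_contra hc
  simp only [Convenient, not_or, not_forall, not_not] at hc
  obtain ⟨⟨p, hp, hpv⟩, p', hp', hpu⟩ := hc
  refine h ⟨p, p', ⟨?_, fun h1 => (unreached_iff.1 hpv).2 p' h1 hp',
    fun h1 => (unreached_iff.1 hpu).2 p h1 hp⟩, hp, hpv, hp', hpu⟩
  rintro rfl
  exact (unreached_iff.1 hpu).1 hp

theorem HasPred.symm {u v : V} (h : D.HasPred u v) : D.HasPred v u := by
  obtain ⟨p, q, h1, h2⟩ := h
  exact ⟨q, p, h1.symm, h2.symm⟩

/-- The chosen orientation of the first missing edge of a path. -/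
def IsFirst (D : OrientedGraph V) (u v : V) : Prop :=
  D.missingGraph.Adj u v ∧ D.JIsPath u ∧ ¬ D.HasPred u v ∧ D.Convenient u v ∧
    (D.Convenient v u → s(u, v).out = (u, v))

/-- On a path only the edge of index zero has no predecessor. -/
theorem source_unique {u v u' v' : V} (hT : D.JIsPath u) (h : D.missingGraph.Adj u v)
    (h' : D.missingGraph.Adj u' v') (hp : ¬ D.HasPred u v) (hp' : ¬ D.HasPred u' v')
    (hR : D.Related u u') : s(u, v) = s(u', v') := by
  obtain ⟨ι, hι⟩ := hT.exists_index
  have key : ∀ a b (hab : D.missingGraph.Adj a b), D.Related u a → ¬ D.HasPred a b →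
      ι ⟨s(a, b), hab⟩ = 0 := by
    intro a b hab hR hpr
    by_contra h0
    have hm : ∃ w ∈ s(a, b), D.Related u w := ⟨a, Sym2.mem_mk_left a b, hR⟩
    obtain ⟨⟨e, he⟩, h1⟩ := (hι ⟨s(a, b), hab⟩ ⟨s(a, b), hab⟩ hm hm).2.2 h0
    induction e with
    | _ p q =>
      rcases (dependency_adj_mk he hab).1 h1 with h2 | h2
      · exact hpr ⟨p, q, he, h2⟩
      · exact hpr (HasPred.symm ⟨p, q, he, h2⟩)
  have h1 := key u v h (related_equivalence.refl u) hp
  have h2 := key u' v' h' hR hp'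
  have := (hι ⟨s(u, v), h⟩ ⟨s(u', v'), h'⟩ ⟨u, Sym2.mem_mk_left u v, related_equivalence.refl u⟩
    ⟨u', Sym2.mem_mk_left u' v', hR⟩).1 (h1.trans h2.symm)
  exact congrArg Subtype.val this

/-- The path structure of a graph in which each class is a path or an interval. -/
def pathStructure (hD : ∀ x : V, D.JIsPath x ∨ D.JIsSNPInterval x) : D.PathStructure where
  T := D.JIsPath
  R := D.Related
  A := D.IsFirst
  equiv := related_equivalence
  rel_of_missing := related_of_missing
  path_congr := JIsPath.congr
  first_missing h := h.1
  first_path h := h.2.1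
  first_reached h := h.2.2.2.1
  first_of_source := by
    intro u v h hT hp
    have hT' := hT.congr (related_of_missing h)
    have hp' : ¬ D.HasPred v u := fun h => hp h.symm
    by_cases h1 : D.Convenient u v
    -- If both orientations are convenient, the chosen representative of the unordered pair breaks
    -- the tie, so that exactly one of them is first.
    · by_cases h2 : D.Convenient v u
      · have h3 : s(s(u, v).out.1, s(u, v).out.2) = s(u, v) := Quot.out_eq _
        rcases Sym2.eq_iff.1 h3 with h4 | h4
        · exact Or.inl ⟨h, hT, hp, h1, fun _ => Prod.ext h4.1 h4.2⟩
        · refine Or.inr ⟨h.symm, hT', hp', h2, fun _ => ?_⟩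
          rw [Sym2.eq_swap]
          exact Prod.ext h4.1 h4.2
      · exact Or.inl ⟨h, hT, hp, h1, fun h => absurd h h2⟩
    · exact Or.inr ⟨h.symm, hT', hp', (convenient_or hp).resolve_left h1, fun h => absurd h h1⟩
  first_unique := by
    intro u v u' v' h h' hR
    rcases Sym2.eq_iff.1 (source_unique h.2.1 h.1 h'.1 h.2.2.1 h'.2.2.1 hR) with h1 | ⟨rfl, rfl⟩
    · exact h1
    · have h1 := h.2.2.2.2 h'.2.2.2.1
      have h2 := h'.2.2.2.2 h.2.2.2.1
      rw [Sym2.eq_swap, h1] at h2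
      exact absurd (congrArg Prod.fst h2) h.1.ne
  loses_unique := by
    intro f w x y x' y' hT hw h h' hl hl'
    obtain ⟨ι, hι⟩ := hT.exists_index
    have hf : ∃ u ∈ s(f, w), D.Related f u :=
      ⟨f, Sym2.mem_mk_left f w, related_equivalence.refl f⟩
    have hy : ∃ u ∈ s(x, y), D.Related f u :=
      ⟨y, Sym2.mem_mk_right x y, related_of_loses hw h hl⟩
    have hy' : ∃ u ∈ s(x', y'), D.Related f u :=
      ⟨y', Sym2.mem_mk_right x' y', related_of_loses hw h' hl'⟩
    have h1 := (hι ⟨s(f, w), hw⟩ ⟨s(x, y), h⟩ hf hy).2.1.1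
      ((dependency_adj_mk hw h).2 (Or.inl hl))
    have h2 := (hι ⟨s(f, w), hw⟩ ⟨s(x', y'), h'⟩ hf hy').2.1.1
      ((dependency_adj_mk hw h').2 (Or.inl hl'))
    exact congrArg Subtype.val ((hι ⟨s(x, y), h⟩ ⟨s(x', y'), h'⟩ hy hy').1 (h1.symm.trans h2))
  rel_of_loses := related_of_loses
  out_congr := by
    intro u v x hT hR hx hux
    have hI := ((hD u).resolve_left hT).1 u (mem_J_iff.2 (related_equivalence.refl u)) v
      (mem_J_iff.2 hR)
    have : x ∈ D.outN u \ D.J u := ⟨hux, fun h => hx (mem_J_iff.1 h)⟩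
    rw [hI.1] at this
    exact this.1
  in_congr := by
    intro u v x hT hR hx hux
    have hI := ((hD u).resolve_left hT).1 u (mem_J_iff.2 (related_equivalence.refl u)) v
      (mem_J_iff.2 hR)
    have : x ∈ D.inN u \ D.J u := ⟨hux, fun h => hx (mem_J_iff.1 h)⟩
    rw [hI.2] at this
    exact this.1

end OrientedGraph

/-! ### The completion along an order of maximal weight. -/

namespace OrientedGraph

variable {V : Type*}

namespace PathStructure

variable {D : OrientedGraph V} (S : D.PathStructure)

/-- The completion of `D` that directs the missing edges of the paths from left to right along an
order. -/
def completion (L : V ≃ Fin (Nat.card V)) : OrientedGraph V where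
  Adj u v := D.Adj u v ∨ (D.missingGraph.Adj u v ∧ S.T u ∧ L u < L v)
  asymm := by
    rintro u v (h | ⟨h, -, hl⟩) (h' | ⟨h', -, hl'⟩)
    · exact D.asymm u v h h'
    · exact h'.2.2 h
    · exact h.2.2 h'
    · exact lt_asymm hl hl'

variable (L : V ≃ Fin (Nat.card V))

theorem completion_adj_iff {u v : V} (h : ¬ S.T u ∨ ¬ S.T v) :
    (S.completion L).Adj u v ↔ D.Adj u v := by
  refine ⟨?_, Or.inl⟩
  rintro (h1 | ⟨h1, h2, -⟩)
  · exact h1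
  · rcases h with h | h
    · exact absurd h2 h
    · exact absurd (S.path_congr (S.rel_of_missing h1) h2) h

theorem missingGraph_completion_adj {u v : V} :
    (S.completion L).missingGraph.Adj u v ↔ D.missingGraph.Adj u v ∧ ¬ S.T u := by
  constructor
  · rintro ⟨h1, h2, h3⟩
    have h4 : D.missingGraph.Adj u v := ⟨h1, fun h => h2 (Or.inl h), fun h => h3 (Or.inl h)⟩
    refine ⟨h4, fun hT => ?_⟩
    rcases lt_or_gt_of_ne (L.injective.ne h1) with h5 | h5
    · exact h2 (Or.inr ⟨h4, hT, h5⟩)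
    · exact h3 (Or.inr ⟨h4.symm, S.path_congr (S.rel_of_missing h4) hT, h5⟩)
  · rintro ⟨h1, h2⟩
    refine ⟨h1.1, ?_, ?_⟩
    · rw [S.completion_adj_iff L (Or.inl h2)]
      exact h1.2.1
    · rw [S.completion_adj_iff L (Or.inr h2)]
      exact h1.2.2

/-- New arcs have both ends in a path class, so none lies on a directed path of length at most two
between ends outside these classes. Hence the losing relation there, and with it every interval
class, survives the completion. -/
theorem unreached_completion {u v : V} (hu : ¬ S.T u) (hv : ¬ S.T v) :
    (S.completion L).Unreached u v ↔ D.Unreached u v := by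
  rw [unreached_iff, unreached_iff, S.completion_adj_iff L (Or.inl hu)]
  refine and_congr_right fun _ => forall_congr' fun w => ?_
  rw [S.completion_adj_iff L (Or.inl hu), S.completion_adj_iff L (Or.inr hv)]

theorem loses_completion {x y a b : V} (hx : ¬ S.T x) (hy : ¬ S.T y) (ha : ¬ S.T a)
    (hb : ¬ S.T b) : (S.completion L).Loses x y a b ↔ D.Loses x y a b := by
  rw [loses_iff, loses_iff, S.unreached_completion L hx hb, S.unreached_completion L hy ha,
    S.completion_adj_iff L (Or.inl hx), S.completion_adj_iff L (Or.inl hy)]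

theorem loses_of_missing_completion {x y a b : V} (h : (S.completion L).missingGraph.Adj x y)
    (h' : (S.completion L).missingGraph.Adj a b) :
    (S.completion L).Loses x y a b ↔ D.Loses x y a b := by
  have h1 := (S.missingGraph_completion_adj L).1 h
  have h2 := (S.missingGraph_completion_adj L).1 h.symm
  have h3 := (S.missingGraph_completion_adj L).1 h'
  have h4 := (S.missingGraph_completion_adj L).1 h'.symm
  exact S.loses_completion L h1.2 h2.2 h3.2 h4.2

theorem step_completion_iff (hR : ∀ u v, S.R u v ↔ D.Related u v) {u v : V} (hu : ¬ S.T u) :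
    (S.completion L).Step u v ↔ D.Step u v := by
  have hT : ∀ x y, D.Step x y → ¬ S.T x → ¬ S.T y := fun x y h hx hy =>
    hx (S.path_congr ((hR y x).2 (related_equivalence.symm (Relation.ReflTransGen.single h))) hy)
  rw [step_iff, step_iff]
  constructor
  · rintro ⟨x, y, a, b, g1, g2, h1, h2, h3⟩
    refine ⟨x, y, a, b, ((S.missingGraph_completion_adj L).1 g1).1,
      ((S.missingGraph_completion_adj L).1 g2).1, h1, h2, ?_⟩
    rwa [S.loses_of_missing_completion L g1 g2, S.loses_of_missing_completion L g1 g2.symm,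
      S.loses_of_missing_completion L g2 g1, S.loses_of_missing_completion L g2 g1.symm] at h3
  · rintro ⟨x, y, a, b, he, he', h1, h2, h3⟩
    have hx : ¬ S.T x := hT u x (step_iff.2 ⟨x, y, x, y, he, he, h1, Sym2.mem_mk_left x y,
      Or.inl rfl⟩) hu
    have ha : ¬ S.T a := hT u a (step_iff.2 ⟨x, y, a, b, he, he', h1, Sym2.mem_mk_left a b, h3⟩) hu
    have g1 := (S.missingGraph_completion_adj L).2 ⟨he, hx⟩
    have g2 := (S.missingGraph_completion_adj L).2 ⟨he', ha⟩
    refine ⟨x, y, a, b, g1, g2, h1, h2, ?_⟩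
    rwa [S.loses_of_missing_completion L g1 g2, S.loses_of_missing_completion L g1 g2.symm,
      S.loses_of_missing_completion L g2 g1, S.loses_of_missing_completion L g2 g1.symm]

theorem related_completion_iff (hR : ∀ u v, S.R u v ↔ D.Related u v) {u v : V} (hu : ¬ S.T u) :
    (S.completion L).Related u v ↔ D.Related u v := by
  have hT : ∀ x, D.Related u x → ¬ S.T x := fun x h hx =>
    hu (S.path_congr ((hR x u).2 (related_equivalence.symm h)) hx)
  constructor
  · intro h
    induction h with
    | refl => exact related_equivalence.refl u
    | tail _ hs ih => exact ih.tail ((S.step_completion_iff L hR (hT _ ih)).1 hs)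
  · intro h
    induction h with
    | refl => exact related_equivalence.refl u
    | tail h hs ih => exact ih.tail ((S.step_completion_iff L hR (hT _ h)).2 hs)

theorem J_completion (hR : ∀ u v, S.R u v ↔ D.Related u v) {u : V} (hu : ¬ S.T u) :
    (S.completion L).J u = D.J u := by
  ext v
  rw [mem_J_iff, mem_J_iff, S.related_completion_iff L hR hu]

/-- All missing edges of the completion lie in classes that are not paths. These classes are the
same as in `D`, and they remain intervals because no arc at their vertices was added. -/
theorem isGood_completion (hR : ∀ u v, S.R u v ↔ D.Related u v) : (S.completion L).IsGood := by
  intro ξ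
  induction ξ using SimpleGraph.ConnectedComponent.ind with
  | _ C =>
  induction C using SimpleGraph.ConnectedComponent.ind with
  | _ e =>
  obtain ⟨x, y, hxy⟩ : ∃ x y, e.1 = s(x, y) := ⟨e.1.out.1, e.1.out.2, (Quot.out_eq _).symm⟩
  have hx : x ∈ e.1 := hxy ▸ Sym2.mem_mk_left x y
  have hm : (S.completion L).missingGraph.Adj x y := by
    have := e.2
    rwa [hxy] at this
  have hT := ((S.missingGraph_completion_adj L).1 hm).2
  have h1 : (S.completion L).KK ((S.completion L).intervalOf e) = D.J x :=
    (KK_eq_J hx).trans (S.J_completion L hR hT)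
  change (S.completion L).IsInterval ((S.completion L).KK ((S.completion L).intervalOf e))
  rw [h1]
  have hmem : ∀ {u}, u ∈ D.J x ↔ S.R x u := fun {u} => by rw [mem_J_iff, hR]
  have hTu : ∀ u ∈ D.J x, ¬ S.T u := fun u hu h =>
    hT (S.path_congr (S.equiv.symm (hmem.1 hu)) h)
  have key : ∀ u ∈ D.J x, ∀ v ∈ D.J x,
      (S.completion L).outN u \ D.J x ⊆ (S.completion L).outN v \ D.J x ∧
      (S.completion L).inN u \ D.J x ⊆ (S.completion L).inN v \ D.J x := by
    intro u hu v hv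
    have huv : S.R u v := S.equiv.trans (S.equiv.symm (hmem.1 hu)) (hmem.1 hv)
    have hnot : ∀ z, z ∉ D.J x → ¬ S.R u z := fun z hz h =>
      hz (hmem.2 (S.equiv.trans (hmem.1 hu) h))
    constructor
    · rintro z ⟨hz, hz'⟩
      exact ⟨Or.inl (S.out_congr (hTu u hu) huv (hnot z hz')
        ((S.completion_adj_iff L (Or.inl (hTu u hu))).1 hz)), hz'⟩
    · rintro z ⟨hz, hz'⟩
      exact ⟨Or.inl (S.in_congr (hTu u hu) huv (hnot z hz')
        ((S.completion_adj_iff L (Or.inr (hTu u hu))).1 hz)), hz'⟩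
  exact fun u hu v hv => ⟨(key u hu v hv).1.antisymm (key v hv u hu).1,
    (key u hu v hv).2.antisymm (key v hv u hu).2⟩

variable [Fintype V] {N : ℝ}

/-- The median orders of the completion along an order of maximal weight are themselves of maximal
weight. -/
theorem isMaxOrder_of_completion (hN : 1 ≤ N) (h₀ : IsMaxOrder (S.weight N) (positions L))
    {q : V → ℝ} (hq : IsMaxOrder (S.completion L).arcWeight q) : IsMaxOrder (S.weight N) q := by
  -- On forward pairs the two weights differ only at missing edges of path classes, where the
  -- completion has the full weight one.
  have h1 : ∀ u v, positions L u < positions L v →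
      S.weight N u v ≤ (S.completion L).arcWeight u v := by
    intro u v huv
    rw [positions_lt] at huv
    by_cases h : (S.completion L).Adj u v
    · rw [arcWeight_of_adj h, S.weight_skew]
      linarith [S.neg_one_le_weight hN v u]
    by_cases h' : D.Adj v u
    · rw [S.weight_skew, arcWeight_skew, S.weight_of_adj N h',
        arcWeight_of_adj (D := S.completion L) (Or.inl h')]
    have hne : u ≠ v := by
      rintro rfl
      exact lt_irrefl _ huv
    have hm : D.missingGraph.Adj u v := ⟨hne, fun h2 => h (Or.inl h2), h'⟩
    have hT : ¬ S.T u := fun hT => h (Or.inr ⟨hm, hT, huv⟩)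
    have hT' : ¬ S.T v := fun h2 => hT (S.path_congr (S.rel_of_missing hm.symm) h2)
    have h2 : ¬ (S.completion L).Adj v u := by
      rwa [S.completion_adj_iff L (Or.inl hT')]
    have hA : ¬ S.A u v := fun h => hT (S.first_path h)
    have hA' : ¬ S.A v u := fun h => hT' (S.first_path h)
    have : S.weight N u v = 0 := by
      simp [weight, hm.2.1, hm.2.2, hA, hA', hT]
    simp [this, arcWeight, h, h2]
  refine h₀.of_forward h1 (fun u v huv => ?_) hq
  rw [S.weight_skew, arcWeight_skew, neg_le_neg_iff]
  rcases lt_or_eq_of_le (not_lt.1 huv) with h | h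
  · exact h1 v u h
  · have := positions_injective L h
    subst this
    have h2 := S.weight_skew N v v
    have h3 := arcWeight_skew (S.completion L) v v
    linarith

end PathStructure

/-- A graph in which each `J(x)` is a directed path or an interval has a good completion whose feed
vertices yield vertices with the second neighbourhood property. -/
theorem exists_goodCompletion [Finite V] (D : OrientedGraph V)
    (hD : ∀ x : V, D.JIsPath x ∨ D.JIsSNPInterval x) :
    ∃ D' : OrientedGraph V, D.IsGoodCompletion D' ∧
      ∀ f : V, D'.IsFeed f → ∃ p ∈ D'.J f, D'.SNP p ∧ D.SNP p := by
  have := Fintype.ofFinite V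
  set S := pathStructure hD with hS
  have hR : ∀ u v, S.R u v ↔ D.Related u v := fun _ _ => Iff.rfl
  have hN : (1 : ℝ) ≤ (Fintype.card V : ℝ) + 1 := by
    have : (0 : ℝ) ≤ Fintype.card V := by positivity
    linarith
  obtain ⟨L, hL⟩ := exists_isMaxOrder (S.weight ((Fintype.card V : ℝ) + 1))
  refine ⟨S.completion L, ⟨fun _ _ => Or.inl, S.isGood_completion L hR⟩, ?_⟩
  rintro f ⟨L', hL', hf⟩
  have hq' := hL'.isMaxOrder
  have hq := S.isMaxOrder_of_completion L hN hL hq'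
  have hlast : ∀ v, positions L' v ≤ positions L' f := by
    intro v
    rw [← not_lt, positions_lt, not_lt]
    exact hf v
  by_cases hT : S.T f
  · refine ⟨f, mem_J_iff.2 (related_equivalence.refl f), ?_, S.snp_of_path le_rfl hq hlast hT⟩
    refine snp_of_last_of_isWhole hq' hlast
      (fun u hu => ((S.missingGraph_completion_adj L).1 hu).2 hT) fun u b hub hfu => ?_
    obtain ⟨h1, h2⟩ := (S.missingGraph_completion_adj L).1 hub
    refine Or.inl (S.in_congr h2 (S.rel_of_missing h1) (fun h => h2 ?_)
      ((S.completion_adj_iff L (Or.inr h2)).1 hfu))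
    exact S.path_congr (S.equiv.symm h) hT
  · obtain ⟨hI, p, hp⟩ := (hD f).resolve_left hT
    have hJ : D.J f = {u | S.R f u} := by
      ext u
      exact mem_J_iff
    have h1 := S.ncard_outside_le hN hq hlast hT
    rw [← hJ] at h1
    have h2 : D.SNP p := snp_of_induce hI (mem_J_iff.2 (related_equivalence.refl f)) h1 p hp
    have hTp : ¬ S.T p := fun h =>
      hT (S.path_congr (S.equiv.symm ((hR f p).2 (mem_J_iff.1 p.2))) h)
    -- The vertex `p` is in no path class, so the completion adds no arc at it.
    refine ⟨p, ?_, h2.of_le ?_ fun _ _ => Or.inl, h2⟩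
    · rw [S.J_completion L hR hT]
      exact p.2
    · ext u
      exact S.completion_adj_iff L (Or.inl hTp)

end OrientedGraph

end SecondNeighbourhood

theorem theorem2p8 {V : Type*} [Finite V] (D : OrientedGraph V)
    (hD : ∀ x : V, D.JIsPath x ∨ D.JIsSNPInterval x) :
    ∃ D' : OrientedGraph V, D.IsGoodCompletion D' ∧
      ∀ f : V, D'.IsFeed f → ∃ p ∈ D'.J f, D'.SNP p ∧ D.SNP p :=
  D.exists_goodCompletion hD
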